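/- **Setting.** For $\tau>0$ let $G(z;\tau)$ be the (Barnes) double gamma function $$G(z;\tau)=\frac{1}{\tau\,\Gamma(z)}\exp\Big[\tilde a(\tau)\frac z\tau+\tilde b(\tau)\frac{z^2}{2\tau^2}\Big]\prod_{m=1}^{\infty}\frac{\Gamma(m\tau)}{\Gamma(z+m\tau)}\exp\Big[z\psi(m\tau)+\frac{z^2}{2}\psi'(m\tau)\Big],$$ where $\psi$ is the digamma function, $\tilde a(\tau)=\frac\tau2\log(2\pi\tau)+\frac12\log\tau-\tau C(\tau)$, $\tilde b(\tau)=-\tau\log\tau-\tau^2D(\tau)$, and $C(\tau)=\lim_{m\to\infty}\big[\sum_{k=1}^{m-1}\psi(k\tau)+\frac12\psi(m\tau)-\frac1\tau\log\frac{\Gamma(m\tau)}{\sqrt{2\pi}}\big]$, $D(\tau)=\lim_{m\to\infty}\big[\sum_{k=1}^{m-1}\psi'(k\tau)+\frac12\psi'(m\tau)-\frac1\tau\psi(m\tau)\big]$. For integers $0\le n\le p$, $0\le m\le q$, for $\varepsilon,a_i,b_i\in\mathbb C$ and $\alpha_i,\beta_i>0$, the Fox-Barnes function is $$I^{m,n}_{p,q}\Big[Z;\tau,\varepsilon\,\Big|\,{(a_i,\alpha_i)_{1,p}\atop(b_i,\beta_i)_{1,q}}\Big]=\frac1{2\pi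 i}\int_{\mathcal C}\frac{\prod_{i=1}^mG(b_i+\beta_is;\tau)\prod_{i=1}^nG(1+\tau-a_i-\alpha_is;\tau)}{\prod_{i=m+1}^qG(1+\tau-b_i-\beta_is;\tau)\prod_{i=n+1}^pG(a_i+\alpha_is;\tau)}\,e^{\pi\varepsilon s^2/\tau}Z^{-s}\,ds .$$ Here $Z=e^w$ is a point of the Riemann surface of the logarithm ($Z^{-s}=e^{-sw}$). The contour $\mathcal C$ is a simple, piecewise $C^1$ curve which starts with a half-line in the lower half-plane and terminates with a half-line in the upper half-plane (for instance a vertical line or a loop around the negative or the positive real direction). It leaves to its left the points $-(a_j+i\tau+l)/\alpha_j$ ($n<j\le p$; $i,l=0,1,2,\dots$) and to its right the points $(-b_j+i\tau+l)/\beta_j$ ($m<j\le q$; $i,l=1,2,\dots$). **Proposition.** Let $k\in\{1,2,\dots\}$ and $\sigma>0$. Suppose that the integral defining $I^{m,n}_{p,q}[\,\cdot\,;\tau,\varepsilon\,|\,\cdot\,]$ over $\mathcal C$ converges absolutely in a neighbourhood of the point $Z$ at which it is evaluated, namely $Z=z^\sigma$ in (i), (ii) and $Z=(cz+d)^{\pm\sigma}$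 in (iii), (iv). All powers of $z$ (of $cz+d$) are formed with one holomorphic branch of $\log z$ (of $\log(cz+d)$) near the given point. Then the differentiated functions below are holomorphic near that point, the integrals on the right-hand sides converge absolutely over the same contour $\mathcal C$ (over $\mathcal C-(\omega-k)/\sigma$ in the third expression of (i)), and the following holds. (i) For $\omega\in\mathbb C$, $$\begin{aligned} \frac{d^k}{dz^k}&\Big[z^\omega I^{m,n}_{p,q}\Big[z^\sigma;\tau,\varepsilon\Big|{(a_i,\alpha_i)_{1,p}\atop(b_i,\beta_i)_{1,q}}\Big]\Big]\\ &=\tau^kz^{\omega-k}I^{m,n+2}_{p+2,q+2}\Big[z^\sigma;\tau,\varepsilon\Big|{(-\omega,\sigma),(-\omega+k+\tau,\sigma),(a_i,\alpha_i)_{1,p}\atop(b_i,\beta_i)_{1,q},(-\omega+\tau,\sigma),(-\omega+k,\sigma)}\Big]\\ &=(-\tau)^kz^{\omega-k}I^{m+2,n}_{p+2,q+2}\Big[z^\sigma;\tau,\varepsilon\Big|{(a_i,\alpha_i)_{1,p},(k-\omega,\sigma),(\tau-\omega,\sigma)\atop(k+\tau-\omega,\sigma),(-\omega,\sigma),(b_i,\beta_i)_{1,q}}\Big]\\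 &=\tau^ke^{\pi\varepsilon[(\omega-k)/\sigma]^2/\tau}I^{m,n+2}_{p+2,q+2}\Big[e^{-2\pi\varepsilon(\omega-k)/(\sigma\tau)}z^\sigma;\tau,\varepsilon\Big|{(-k,\sigma),(\tau,\sigma),(a_i+\alpha_i(\omega-k)/\sigma,\alpha_i)_{1,p}\atop(b_i+\beta_i(\omega-k)/\sigma,\beta_i)_{1,q},(\tau-k,\sigma),(0,\sigma)}\Big]. \end{aligned}$$ (ii) For $\omega,c_1,\dots,c_k\in\mathbb C$, $$\begin{aligned} \prod_{j=1}^k&\Big(z\frac d{dz}-c_j\Big)\Big[z^\omega I^{m,n}_{p,q}\Big[z^\sigma;\tau,\varepsilon\Big|{(a_i,\alpha_i)_{1,p}\atop(b_i,\beta_i)_{1,q}}\Big]\Big]\\ &=\tau^kz^\omega I^{m,n+2k}_{p+2k,q+2k}\Big[z^\sigma;\tau,\varepsilon\Big|{(c_j-\omega,\sigma)_{1,k},(1+\tau+c_j-\omega,\sigma)_{1,k},(a_i,\alpha_i)_{1,p}\atop(b_i,\beta_i)_{1,q},(\tau+c_j-\omega,\sigma)_{1,k},(1+c_j-\omega,\sigma)_{1,k}}\Big]\\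 &=(-\tau)^kz^\omega I^{m+2k,n}_{p+2k,q+2k}\Big[z^\sigma;\tau,\varepsilon\Big|{(a_i,\alpha_i)_{1,p},(1+c_j-\omega,\sigma)_{1,k},(\tau+c_j-\omega,\sigma)_{1,k}\atop(1+\tau+c_j-\omega,\sigma)_{1,k},(c_j-\omega,\sigma)_{1,k},(b_i,\beta_i)_{1,q}}\Big]. \end{aligned}$$ (iii) For $c,d\in\mathbb C$, $$\frac{d^k}{dz^k}I^{m,n}_{p,q}\Big[(cz+d)^\sigma;\tau,\varepsilon\Big|{(a_i,\alpha_i)_{1,p}\atop(b_i,\beta_i)_{1,q}}\Big]=\frac{\tau^kc^k}{(cz+d)^k}I^{m,n+2}_{p+2,q+2}\Big[(cz+d)^\sigma;\tau,\varepsilon\Big|{(0,\sigma),(k+\tau,\sigma),(a_i,\alpha_i)_{1,p}\atop(b_i,\beta_i)_{1,q},(\tau,\sigma),(k,\sigma)}\Big].$$ (iv) For $c,d\in\mathbb C$, $$\frac{d^k}{dz^k}I^{m,n}_{p,q}\Big[(cz+d)^{-\sigma};\tau,\varepsilon\Big|{(a_i,\alpha_i)_{1,p}\atop(b_i,\beta_i)_{1,q}}\Big]=\frac{\tau^kc^k}{(cz+d)^k}I^{m+2,n}_{p+2,q+2}\Big[(cz+d)^{-\sigma};\tau,\varepsilon\Big|{(a_i,\alpha_i)_{1,p},(1,\sigma),(1-k+\tau,\sigma)\atop(1+\tau,\sigma),(1-k,\sigma),(b_i,\beta_i)_{1,q}}\Big].$$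 -/

import Mathlib

open Filter Topology

noncomputable section

/-! ### The double gamma function -/

/-- `C(τ) = lim_m [∑_{k=1}^{m-1} ψ(kτ) + ψ(mτ)/2 - (1/τ) log (Γ(mτ)/√(2π))]`. -/
def doubleGammaC (τ : ℝ) : ℂ :=
  limUnder atTop (fun m : ℕ =>
    (∑ k ∈ Finset.Ico 1 m, Complex.digamma ((k : ℂ) * τ)) + Complex.digamma ((m : ℂ) * τ) / 2
      - ((Real.log (Real.Gamma (m * τ) / Real.sqrt (2 * Real.pi)) / τ : ℝ) : ℂ))

/-- `D(τ) = lim_m [∑_{k=1}^{m-1} ψ'(kτ) + ψ'(mτ)/2 - (1/τ) ψ(mτ)]`. -/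
def doubleGammaD (τ : ℝ) : ℂ :=
  limUnder atTop (fun m : ℕ =>
    (∑ k ∈ Finset.Ico 1 m, deriv Complex.digamma ((k : ℂ) * τ))
      + deriv Complex.digamma ((m : ℂ) * τ) / 2 - Complex.digamma ((m : ℂ) * τ) / τ)

/-- `ã(τ) = (τ/2) log (2πτ) + (1/2) log τ - τ C(τ)`. -/
def doubleGammaA (τ : ℝ) : ℂ :=
  ((τ / 2 * Real.log (2 * Real.pi * τ) + Real.log τ / 2 : ℝ) : ℂ) - τ * doubleGammaC τ

/-- `b̃(τ) = -τ log τ - τ² D(τ)`. -/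
def doubleGammaB (τ : ℝ) : ℂ :=
  ((-(τ * Real.log τ) : ℝ) : ℂ) - (τ : ℂ) ^ 2 * doubleGammaD τ

/-- The double gamma function `G(z; τ)`, for `τ > 0`, as Barnes' product of gamma functions
`(1/(τΓ(z))) exp(ã z/τ + b̃ z²/(2τ²)) ∏_{m≥1} (Γ(mτ)/Γ(z+mτ)) exp(z ψ(mτ) + (z²/2) ψ'(mτ))`.
(Mathlib's `Complex.Gamma` is `0` at its poles, so that its inverse is the entire function `1/Γ`.) -/
def doubleGamma (z : ℂ) (τ : ℝ) : ℂ :=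
  ((τ : ℂ) * Complex.Gamma z)⁻¹
    * Complex.exp (doubleGammaA τ * z / τ + doubleGammaB τ * z ^ 2 / (2 * (τ : ℂ) ^ 2))
    * ∏' j : ℕ,
        (Complex.Gamma (((j : ℂ) + 1) * τ) / Complex.Gamma (z + ((j : ℂ) + 1) * τ)
          * Complex.exp (z * Complex.digamma (((j : ℂ) + 1) * τ)
              + z ^ 2 / 2 * deriv Complex.digamma (((j : ℂ) + 1) * τ)))

/-! ### Contours -/

/-- An oriented simple contour that starts with a half-line of direction `θ₋` (coming from infinity
in the lower half-plane, `-π ≤ θ₋ ≤ 0`) and terminates with a half-line of direction `θ₊` (going to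
infinity in the upper half-plane, `0 ≤ θ₊ ≤ π`). Vertical lines are the case
`(θ₋, θ₊) = (-π/2, π/2)`, left loops the case `(-π, π)` and right loops the case `(0, 0)`. -/
structure MBContour where
  /-- the parametrization -/
  path : ℝ → ℂ
  /-- direction of the initial half-line -/
  θstart : ℝ
  /-- direction of the final half-line -/
  θend : ℝ
  θstart_mem : θstart ∈ Set.Icc (-Real.pi) 0
  θend_mem : θend ∈ Set.Icc 0 Real.pi
  continuous_path : Continuous path
  injective_path : Function.Injective path
  smooth_path : ∃ E : Set ℝ, E.Finite ∧ ∀ t, t ∉ E → ContDiffAt ℝ 1 path t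
  path_start : ∃ (s₀ : ℂ) (T : ℝ), ∀ t ≤ T,
    path t = s₀ + ((-t : ℝ) : ℂ) * Complex.exp (Complex.I * θstart)
  path_end : ∃ (s₁ : ℂ) (T : ℝ), ∀ t ≥ T,
    path t = s₁ + (t : ℂ) * Complex.exp (Complex.I * θend)

namespace MBContour

/-- The contour leaves the point `p` to its left: seen from `p`, the direction of the moving point
turns continuously from `θ₋` to `θ₊`. -/
def LeavesLeft (C : MBContour) (p : ℂ) : Prop :=
  (∀ t, C.path t ≠ p) ∧ ∃ φ : ℝ → ℝ, Continuous φ ∧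
    (∀ t, C.path t - p = ((‖C.path t - p‖ : ℝ) : ℂ) * Complex.exp (Complex.I * φ t)) ∧
    Tendsto φ atBot (𝓝 C.θstart) ∧ Tendsto φ atTop (𝓝 C.θend)

/-- The contour leaves the point `p` to its right: seen from `p`, the direction of the moving point
turns continuously from `θ₋` to `θ₊ - 2π`. -/
def LeavesRight (C : MBContour) (p : ℂ) : Prop :=
  (∀ t, C.path t ≠ p) ∧ ∃ φ : ℝ → ℝ, Continuous φ ∧
    (∀ t, C.path t - p = ((‖C.path t - p‖ : ℝ) : ℂ) * Complex.exp (Complex.I * φ t)) ∧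
    Tendsto φ atBot (𝓝 C.θstart) ∧ Tendsto φ atTop (𝓝 (C.θend - 2 * Real.pi))

/-- The contour translated by `ρ`. -/
def translate (C : MBContour) (ρ : ℂ) : MBContour where
  path := fun t => C.path t + ρ
  θstart := C.θstart
  θend := C.θend
  θstart_mem := C.θstart_mem
  θend_mem := C.θend_mem
  continuous_path := C.continuous_path.add continuous_const
  injective_path := fun _ _ h => C.injective_path (add_right_cancel h)
  smooth_path := by
    obtain ⟨E, hE, h⟩ := C.smooth_path
    exact ⟨E, hE, fun t ht => (h t ht).add contDiffAt_const⟩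
  path_start := by
    obtain ⟨s, T, h⟩ := C.path_start
    exact ⟨s + ρ, T, fun t ht => by rw [h t ht]; ring⟩
  path_end := by
    obtain ⟨s, T, h⟩ := C.path_end
    exact ⟨s + ρ, T, fun t ht => by rw [h t ht]; ring⟩

end MBContour

/-! ### The Fox-Barnes `I`-function

The parameters of `I^{m,n}_{p,q}` are two numbers `m`, `n` and two lists of pairs
`A = [(a₁, α₁), …, (a_p, α_p)]` and `B = [(b₁, β₁), …, (b_q, β_q)]` with `n ≤ p` and `m ≤ q`. -/

/-- The ratio of products of double gamma functions
`∏_{i≤m} G(bᵢ+βᵢs) ∏_{i≤n} G(1+τ-aᵢ-αᵢs) / (∏_{i>m} G(1+τ-bᵢ-βᵢs) ∏_{i>n} G(aᵢ+αᵢs))`. -/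
def foxBarnesKernel (τ : ℝ) (m n : ℕ) (A B : List (ℂ × ℝ)) (s : ℂ) : ℂ :=
  (((B.take m).map fun x => doubleGamma (x.1 + x.2 * s) τ).prod
    * ((A.take n).map fun x => doubleGamma (1 + τ - x.1 - x.2 * s) τ).prod)
  / (((B.drop m).map fun x => doubleGamma (1 + τ - x.1 - x.2 * s) τ).prod
    * ((A.drop n).map fun x => doubleGamma (x.1 + x.2 * s) τ).prod)

/-- The integrand `𝓘(s) e^{π ε s²/τ} Z^{-s}` at the point `Z = e^w` of the Riemann surface of the
logarithm, that is, with `Z^{-s} = e^{-sw}`. -/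
def foxBarnesIntegrand (τ : ℝ) (ε : ℂ) (m n : ℕ) (A B : List (ℂ × ℝ)) (w s : ℂ) : ℂ :=
  foxBarnesKernel τ m n A B s * Complex.exp (Real.pi * ε * s ^ 2 / τ) * Complex.exp (-(s * w))

/-- The contour separates the poles: the points `-(aⱼ + iτ + l)/αⱼ` (`j > n`; `i, l ≥ 0`) lie to its
left and the points `(-bⱼ + iτ + l)/βⱼ` (`j > m`; `i, l ≥ 1`) lie to its right. -/
def MBContour.Separates (C : MBContour) (τ : ℝ) (m n : ℕ) (A B : List (ℂ × ℝ)) : Prop :=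
  (∀ x ∈ A.drop n, ∀ i l : ℕ, C.LeavesLeft (-(x.1 + i * τ + l) / x.2)) ∧
  (∀ x ∈ B.drop m, ∀ i l : ℕ, 1 ≤ i → 1 ≤ l → C.LeavesRight ((-x.1 + i * τ + l) / x.2))

/-- The contour integral that defines `I^{m,n}_{p,q}[e^w; τ, ε | A; B]` converges absolutely. -/
def FoxBarnesConverges (τ : ℝ) (ε : ℂ) (m n : ℕ) (A B : List (ℂ × ℝ)) (C : MBContour) (w : ℂ) :
    Prop :=
  MeasureTheory.Integrable
    (fun t : ℝ => foxBarnesIntegrand τ ε m n A B w (C.path t) * deriv C.path t)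

/-- The Fox-Barnes function `I^{m,n}_{p,q}[Z; τ, ε | A; B] = (1/2πi) ∫_C 𝓘(s) e^{π ε s²/τ} Z^{-s} ds`
at the point `Z = e^w` of the Riemann surface of the logarithm. -/
def foxBarnesI (τ : ℝ) (ε : ℂ) (m n : ℕ) (A B : List (ℂ × ℝ)) (C : MBContour) (w : ℂ) : ℂ :=
  (2 * Real.pi * Complex.I)⁻¹
    * ∫ t : ℝ, foxBarnesIntegrand τ ε m n A B w (C.path t) * deriv C.path t

/-! ### Branches and operators -/

/-- Near `z`, the function `L` is a holomorphic branch of `log f`. -/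
def IsLogBranchAt (L f : ℂ → ℂ) (z : ℂ) : Prop :=
  AnalyticAt ℂ L z ∧ ∀ᶠ x in 𝓝 z, Complex.exp (L x) = f x

/-- The operator `z d/dz - c`. -/
def eulerOp (c : ℂ) (f : ℂ → ℂ) : ℂ → ℂ := fun z => z * deriv f z - c * f z

/-- The operator `∏_{j=1}^k (z d/dz - c_j)`. -/
def eulerProd {k : ℕ} (c : Fin k → ℂ) (f : ℂ → ℂ) : ℂ → ℂ := (List.ofFn c).foldr eulerOp f

end

/-! Differentiating z^(ω-σs) lowers the exponent by one and brings down ω-σs, so k derivatives under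
the integral insert the falling factorial of ω-σs, and each z d/dz - c_j inserts ω-σs-c_j. The point
is that these polynomials are, up to a power of ±τ, quotients of double gamma functions, hence
nothing but extra parameter pairs in the kernel. This comes from G(z+τ+1)G(z) = (z/τ)G(z+τ)G(z+1)
(`doubleGamma_add_add_mul`), telescoped in `doubleGamma_ratio_nat`.

The two first-order functional equations of G are not needed for this. The mixed second difference
in the steps 1 and τ cancels the linear exponent ã z/τ, so nothing about C(τ) is used, not even that
its limit exists. The quadratic exponent leaves e^(b̃/τ) = e^(-τD)/τ, and e^(-τD) has to cancel
against the limit of a telescoping product. This requires that the limit D(τ) exists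
(`exists_tendsto_doubleGammaDSeq`, from the monotonicity of ψ') and that Barnes' product converges,
with nonzero value off the lattice (`summable_barnesFactor_sub_one`: its factors are 1 + O(m⁻²)).

On the analytic side, absolute convergence for all w near w₀ dominates the differentiated integrand
and is inherited by it (`hasDerivAt_expIntegral`), so the argument iterates. The quotient identities
are proved off a shifted lattice, which an injective contour meets for only countably many
parameters (`MBContour.ae_offLattice`). The third expression in (i) is the first one after a
translation of the contour, with the square completed in e^(πεs²/τ) (`foxBarnes_translate`). -/

noncomputable section

/-! ### The digamma function on the positive half-line -/

/-- The real digamma function, the derivative of `log Γ`. -/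
def realDigamma (x : ℝ) : ℝ := deriv (Real.log ∘ Real.Gamma) x

/-- The real trigamma function as the series `∑ (x + n)⁻²`. -/
def realTrigamma (x : ℝ) : ℝ := ∑' n : ℕ, 1 / (x + n) ^ 2

lemma hasDerivAt_log_Gamma {x : ℝ} (hx : 0 < x) :
    HasDerivAt (Real.log ∘ Real.Gamma) (realDigamma x) x := by
  have : DifferentiableAt ℝ (Real.log ∘ Real.Gamma) x := by
    refine (Real.differentiableAt_Gamma fun m => ?_).log (Real.Gamma_pos_of_pos hx).ne'
    exact ne_of_gt (lt_of_le_of_lt (neg_nonpos.mpr m.cast_nonneg) hx)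
  exact this.hasDerivAt

lemma log_Gamma_add_one {x : ℝ} (hx : 0 < x) :
    (Real.log ∘ Real.Gamma) (x + 1) = (Real.log ∘ Real.Gamma) x + Real.log x := by
  simp only [Function.comp_apply, Real.Gamma_add_one hx.ne',
    Real.log_mul hx.ne' (Real.Gamma_pos_of_pos hx).ne', add_comm]

lemma realDigamma_add_one {x : ℝ} (hx : 0 < x) :
    realDigamma (x + 1) = realDigamma x + 1 / x := by
  have h1 : HasDerivAt (fun y => (Real.log ∘ Real.Gamma) (y + 1)) (realDigamma (x + 1)) x :=
    (hasDerivAt_log_Gamma (by positivity : 0 < x + 1)).comp_add_const x 1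
  have h2 : HasDerivAt (fun y => (Real.log ∘ Real.Gamma) y + Real.log y)
      (realDigamma x + x⁻¹) x := (hasDerivAt_log_Gamma hx).add (Real.hasDerivAt_log hx.ne')
  rw [one_div]
  refine h1.unique (h2.congr_of_eventuallyEq ?_)
  filter_upwards [eventually_gt_nhds hx] with y hy using log_Gamma_add_one hy

lemma realDigamma_add_nat {x : ℝ} (hx : 0 < x) (N : ℕ) :
    realDigamma (x + N) = realDigamma x + ∑ j ∈ Finset.range N, 1 / (x + j) := by
  induction N with
  | zero => simp
  | succ N ih =>
    rw [Finset.sum_range_succ, ← add_assoc, ← ih, ← realDigamma_add_one (by positivity)]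
    push_cast
    ring_nf

/-- By convexity of log Γ, the slope log x of the chord over [x, x+1] lies between ψ(x) and ψ(x+1);
this lemma and the next are the two halves. -/
lemma realDigamma_le_log {x : ℝ} (hx : 0 < x) : realDigamma x ≤ Real.log x := by
  refine (Real.convexOn_log_Gamma.deriv_le_slope hx (by positivity : (0 : ℝ) < x + 1)
    (by linarith) (hasDerivAt_log_Gamma hx).differentiableAt).trans (le_of_eq ?_)
  rw [slope_def_field, log_Gamma_add_one hx]
  ring

lemma log_le_realDigamma_add_one {x : ℝ} (hx : 0 < x) : Real.log x ≤ realDigamma (x + 1) := by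
  have hx1 : (0 : ℝ) < x + 1 := by positivity
  refine (le_of_eq ?_).trans (Real.convexOn_log_Gamma.slope_le_deriv hx hx1 (by linarith)
    (hasDerivAt_log_Gamma hx1).differentiableAt)
  rw [slope_def_field, log_Gamma_add_one hx]
  ring

lemma tendsto_realDigamma_sub_log :
    Tendsto (fun x => realDigamma x - Real.log x) atTop (𝓝 0) := by
  have h : Tendsto (fun x : ℝ => -(1 / x)) atTop (𝓝 0) := by
    simpa using (tendsto_inv_atTop_zero (𝕜 := ℝ)).neg
  refine tendsto_of_tendsto_of_tendsto_of_le_of_le' h tendsto_const_nhds ?_ ?_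
  · filter_upwards [eventually_gt_atTop 0] with x hx
    have := log_le_realDigamma_add_one hx
    rw [realDigamma_add_one hx] at this
    linarith
  · filter_upwards [eventually_gt_atTop 0] with x hx
    linarith [realDigamma_le_log hx]

lemma tendsto_log_sub_sum {x : ℝ} (hx : 0 < x) :
    Tendsto (fun N : ℕ => Real.log N - ∑ j ∈ Finset.range N, 1 / (x + j)) atTop
      (𝓝 (realDigamma x)) := by
  have hxN : Tendsto (fun N : ℕ => x + (N : ℝ)) atTop atTop :=
    tendsto_atTop_add_const_left _ _ tendsto_natCast_atTop_atTop
  have h1 := tendsto_realDigamma_sub_log.comp hxN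
  have h2 : Tendsto (fun N : ℕ => Real.log (N + x) - Real.log N) atTop (𝓝 0) :=
    (Real.tendsto_log_comp_add_sub_log x).comp tendsto_natCast_atTop_atTop
  have h3 := (tendsto_const_nhds (x := realDigamma x)).sub (h1.add h2)
  simp only [add_zero, sub_zero] at h3
  refine h3.congr fun N => ?_
  simp only [Function.comp_apply]
  rw [realDigamma_add_nat hx, add_comm (N : ℝ) x]
  ring

/-! ### The trigamma series as the derivative of ψ -/

lemma summable_one_div_add_sq {x : ℝ} (hx : 0 < x) :
    Summable fun n : ℕ => 1 / (x + n) ^ 2 := by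
  rw [← summable_nat_add_iff 1]
  refine Summable.of_nonneg_of_le (fun n => by positivity) (fun n => ?_)
    ((summable_nat_add_iff 1).mpr (Real.summable_one_div_nat_pow.mpr one_lt_two))
  gcongr
  linarith

lemma realTrigamma_nonneg (x : ℝ) : 0 ≤ realTrigamma x := tsum_nonneg fun n => by positivity

lemma realTrigamma_anti {x y : ℝ} (hx : 0 < x) (hxy : x ≤ y) :
    realTrigamma y ≤ realTrigamma x := by
  refine Summable.tsum_le_tsum (fun n => ?_) (summable_one_div_add_sq (hx.trans_le hxy))
    (summable_one_div_add_sq hx)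
  gcongr

/-- Subtracting the limit formulas for ψ(x) and ψ(1) removes log N and leaves a convergent series
that can be differentiated term by term. -/
lemma realDigamma_eq_tsum {x : ℝ} (hx : 0 < x) :
    Summable (fun n : ℕ => 1 / (1 + (n : ℝ)) - 1 / (x + n)) ∧
    realDigamma x = realDigamma 1 + ∑' n : ℕ, (1 / (1 + (n : ℝ)) - 1 / (x + n)) := by
  have hs : Summable (fun n : ℕ => 1 / (1 + (n : ℝ)) - 1 / (x + n)) := by
    -- Both denominators 1+n and x+n are at least min 1 x + n, so the terms are O(n⁻²).
    have hm : 0 < min 1 x := lt_min one_pos hx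
    refine Summable.of_norm_bounded ((summable_one_div_add_sq hm).mul_left |x - 1|) fun n => ?_
    have h1 : (0 : ℝ) < 1 + n := by positivity
    have h2 : (0 : ℝ) < x + n := by positivity
    rw [div_sub_div _ _ h1.ne' h2.ne', Real.norm_eq_abs, abs_div, abs_of_pos (mul_pos h1 h2),
      show 1 * (x + (n : ℝ)) - (1 + n) * 1 = x - 1 by ring, div_eq_mul_one_div, sq]
    gcongr
    · exact min_le_left _ _
    · exact min_le_right _ _
  refine ⟨hs, ?_⟩
  have h := (tendsto_log_sub_sum hx).sub (tendsto_log_sub_sum one_pos)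
  have h' := tendsto_nhds_unique hs.hasSum.tendsto_sum_nat (h.congr fun N => by
    rw [Finset.sum_sub_distrib]; ring)
  rw [h']
  ring

lemma hasDerivAt_realDigamma {x : ℝ} (hx : 0 < x) :
    HasDerivAt realDigamma (realTrigamma x) x := by
  have hx2 : 0 < x / 2 := by positivity
  have key : HasDerivAt (fun y : ℝ => ∑' n : ℕ, (1 / (1 + (n : ℝ)) - 1 / (y + n)))
      (∑' n : ℕ, 1 / (x + n) ^ 2) x := by
    -- On (x/2, ∞) the differentiated terms are at most their values at x/2, which are summable.
    refine hasDerivAt_tsum_of_isPreconnected (t := Set.Ioi (x / 2)) (y₀ := x)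
      (g := fun (n : ℕ) (y : ℝ) => 1 / (1 + (n : ℝ)) - 1 / (y + n))
      (g' := fun (n : ℕ) (y : ℝ) => 1 / (y + n) ^ 2)
      (summable_one_div_add_sq hx2) isOpen_Ioi isPreconnected_Ioi (fun n y hy => ?_)
      (fun n y hy => ?_) (by simpa using hx) (realDigamma_eq_tsum hx).1 (by simpa using hx)
    · have hy' : (0 : ℝ) < y + n := by
        have : 0 < y := hx2.trans hy
        positivity
      have := (((hasDerivAt_id y).add_const (n : ℝ)).fun_inv hy'.ne').const_sub (1 / (1 + (n : ℝ)))
      simpa [neg_div] using this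
    · have : x / 2 < y := hy
      rw [Real.norm_eq_abs, abs_of_nonneg (by positivity)]
      gcongr
  refine (key.const_add (realDigamma 1)).congr_of_eventuallyEq ?_
  filter_upwards [eventually_gt_nhds hx] with y hy using (realDigamma_eq_tsum hy).2

lemma exists_realTrigamma_eq_slope {x y : ℝ} (hx : 0 < x) (hxy : x < y) :
    ∃ c ∈ Set.Ioo x y, realTrigamma c = (realDigamma y - realDigamma x) / (y - x) :=
  exists_hasDerivAt_eq_slope realDigamma realTrigamma hxy
    (fun _ ht => (hasDerivAt_realDigamma (hx.trans_le ht.1)).continuousAt.continuousWithinAt)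
    (fun _ ht => hasDerivAt_realDigamma (hx.trans ht.1))

lemma realDigamma_sub_le {x y : ℝ} (hx : 0 < x) (hxy : x < y) :
    (realDigamma y - realDigamma x) / (y - x) ≤ realTrigamma x := by
  obtain ⟨c, hc, h⟩ := exists_realTrigamma_eq_slope hx hxy
  exact h ▸ realTrigamma_anti hx hc.1.le

lemma le_realDigamma_sub {x y : ℝ} (hx : 0 < x) (hxy : x < y) :
    realTrigamma y ≤ (realDigamma y - realDigamma x) / (y - x) := by
  obtain ⟨c, hc, h⟩ := exists_realTrigamma_eq_slope hx hxy
  exact h ▸ realTrigamma_anti (hx.trans hc.1) hc.2.le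

/-- Since ψ' decreases, 0 ≤ ψ'(x) ≤ ψ(x) - ψ(x-1) = 1/(x-1). -/
lemma tendsto_realTrigamma_atTop : Tendsto realTrigamma atTop (𝓝 0) := by
  have h : Tendsto (fun x : ℝ => 1 / (x - 1)) atTop (𝓝 0) := by
    simpa [Function.comp_def, ← sub_eq_add_neg] using (tendsto_inv_atTop_zero (𝕜 := ℝ)).comp
      (tendsto_atTop_add_const_right atTop (-1 : ℝ) tendsto_id)
  refine tendsto_of_tendsto_of_tendsto_of_le_of_le' tendsto_const_nhds h
    (Eventually.of_forall realTrigamma_nonneg) ?_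
  filter_upwards [eventually_gt_atTop 1] with x hx
  have hx' : 0 < x - 1 := by linarith
  have := le_realDigamma_sub hx' (by linarith : x - 1 < x - 1 + 1)
  rw [realDigamma_add_one hx'] at this
  simpa using this

/-! ### Real and complex digamma agree on the positive axis -/

lemma ofReal_ne_neg_nat {x : ℝ} (hx : 0 < x) (m : ℕ) : (x : ℂ) ≠ -m := by
  intro h
  have := congrArg Complex.re h
  simp at this
  have : (0 : ℝ) ≤ m := m.cast_nonneg
  linarith

lemma digamma_ofReal {x : ℝ} (hx : 0 < x) : Complex.digamma x = realDigamma x := by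
  have h1 := (Complex.differentiableAt_Gamma x (ofReal_ne_neg_nat hx)).hasDerivAt.comp_ofReal
  have hd : DifferentiableAt ℝ Real.Gamma x := Real.differentiableAt_Gamma fun m =>
    ne_of_gt (lt_of_le_of_lt (neg_nonpos.mpr m.cast_nonneg) hx)
  have h2 := hd.hasDerivAt.ofReal_comp
  simp only [Complex.Gamma_ofReal] at h1
  have h3 : realDigamma x = deriv Real.Gamma x / Real.Gamma x :=
    (hasDerivAt_log_Gamma hx).unique (hd.hasDerivAt.log (Real.Gamma_pos_of_pos hx).ne')
  rw [Complex.digamma_def, logDeriv_apply, h1.unique h2, h3, Complex.Gamma_ofReal]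
  push_cast
  rfl

lemma differentiableAt_digamma_ofReal {x : ℝ} (hx : 0 < x) :
    DifferentiableAt ℂ Complex.digamma x := by
  have hopen : IsOpen {z : ℂ | 0 < z.re} := isOpen_lt continuous_const Complex.continuous_re
  have hd : DifferentiableOn ℂ Complex.Gamma {z : ℂ | 0 < z.re} := fun z hz =>
    (Complex.differentiableAt_Gamma z fun m h => by
      have hz' : 0 < z.re := hz
      rw [h] at hz'
      simp at hz'
      exact absurd hz' (not_lt.mpr m.cast_nonneg)).differentiableWithinAt
  have hmem : {z : ℂ | 0 < z.re} ∈ 𝓝 (x : ℂ) := hopen.mem_nhds (by simpa using hx)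
  have h := ((hd.deriv hopen).differentiableAt hmem).div (hd.differentiableAt hmem)
    (Complex.Gamma_ne_zero (ofReal_ne_neg_nat hx))
  exact h

lemma deriv_digamma_ofReal {x : ℝ} (hx : 0 < x) :
    deriv Complex.digamma x = realTrigamma x := by
  have h1 := (differentiableAt_digamma_ofReal hx).hasDerivAt.comp_ofReal
  refine h1.unique ((hasDerivAt_realDigamma hx).ofReal_comp.congr_of_eventuallyEq ?_)
  filter_upwards [eventually_gt_nhds hx] with y hy using digamma_ofReal hy

/-! ### The constant `D(τ)` and the convergence of Barnes' product -/

/-- The partial sums whose limit is `D(τ)`. -/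
def doubleGammaDSeq (τ : ℝ) (m : ℕ) : ℝ :=
  (∑ k ∈ Finset.Ico 1 m, realTrigamma (k * τ)) + realTrigamma (m * τ) / 2
    - realDigamma (m * τ) / τ

/-- An integral-test argument: ψ' is decreasing, so the increment of ψ over a step τ, divided by τ,
lies between the values of ψ' at the two ends. Hence the sums `b` increase while b plus the next
term ψ' decreases. The half-weighted end term tends to 0 and does not affect convergence. -/
lemma exists_tendsto_doubleGammaDSeq {τ : ℝ} (hτ : 0 < τ) :
    ∃ d, Tendsto (doubleGammaDSeq τ) atTop (𝓝 d) := by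
  have hpos : ∀ m : ℕ, 0 < ((m + 1 : ℕ) : ℝ) * τ := fun m => by positivity
  have hlt : ∀ m : ℕ, ((m + 1 : ℕ) : ℝ) * τ < ((m + 1 + 1 : ℕ) : ℝ) * τ := fun m => by
    gcongr
    omega
  have hdiff : ∀ m : ℕ, ((m + 1 + 1 : ℕ) : ℝ) * τ - ((m + 1 : ℕ) : ℝ) * τ = τ := fun m => by
    push_cast
    ring
  let b : ℕ → ℝ := fun m =>
    (∑ k ∈ Finset.Ico 1 (m + 1), realTrigamma (k * τ)) - realDigamma ((m + 1 : ℕ) * τ) / τ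
  have hstep : ∀ m, b (m + 1) = b m + (realTrigamma ((m + 1 : ℕ) * τ)
      - (realDigamma ((m + 1 + 1 : ℕ) * τ) - realDigamma ((m + 1 : ℕ) * τ)) / τ) := fun m => by
    simp only [b]
    rw [Finset.sum_Ico_succ_top (by omega)]
    ring
  have hmono : Monotone b := monotone_nat_of_le_succ fun m => by
    have := realDigamma_sub_le (hpos m) (hlt m)
    rw [hdiff] at this
    rw [hstep]
    linarith
  have hanti : Antitone fun m => b m + realTrigamma ((m + 1 : ℕ) * τ) :=
    antitone_nat_of_succ_le fun m => by
      have := le_realDigamma_sub (hpos m) (hlt m)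
      rw [hdiff] at this
      rw [hstep]
      linarith
  have hbdd : BddAbove (Set.range b) := by
    refine ⟨b 0 + realTrigamma ((0 + 1 : ℕ) * τ), ?_⟩
    rintro _ ⟨m, rfl⟩
    have h1 := hanti (Nat.zero_le m)
    have h2 := realTrigamma_nonneg ((m + 1 : ℕ) * τ)
    simp only at h1
    linarith
  have htri : Tendsto (fun m : ℕ => realTrigamma ((m + 1 : ℕ) * τ)) atTop (𝓝 0) :=
    tendsto_realTrigamma_atTop.comp
      ((tendsto_natCast_atTop_atTop.comp (tendsto_add_atTop_nat 1)).atTop_mul_const hτ)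
  refine ⟨_, (tendsto_add_atTop_iff_nat 1).mp
    (((tendsto_atTop_ciSup hmono hbdd).add (htri.div_const 2)).congr fun m => ?_)⟩
  simp only [b, doubleGammaDSeq]
  ring

lemma tendsto_doubleGammaDSeq {τ : ℝ} (hτ : 0 < τ) :
    Tendsto (fun m => (doubleGammaDSeq τ m : ℂ)) atTop (𝓝 (doubleGammaD τ)) := by
  obtain ⟨d, hd⟩ := exists_tendsto_doubleGammaDSeq hτ
  have hd' : Tendsto (fun m => (doubleGammaDSeq τ m : ℂ)) atTop (𝓝 (d : ℂ)) :=
    (Complex.continuous_ofReal.tendsto d).comp hd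
  have heq : (fun m => (doubleGammaDSeq τ m : ℂ)) =ᶠ[atTop] fun m : ℕ =>
      (∑ k ∈ Finset.Ico 1 m, deriv Complex.digamma ((k : ℂ) * τ))
      + deriv Complex.digamma ((m : ℂ) * τ) / 2 - Complex.digamma ((m : ℂ) * τ) / τ := by
    have hc : ∀ k : ℕ, (k : ℂ) * τ = ((k * τ : ℝ) : ℂ) := fun k => by push_cast; rfl
    filter_upwards [eventually_ge_atTop 1] with m hm
    have hmτ : 0 < (m : ℝ) * τ := mul_pos (by exact_mod_cast hm) hτ
    have hsum : ∑ k ∈ Finset.Ico 1 m, deriv Complex.digamma ((k : ℂ) * τ)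
        = ∑ k ∈ Finset.Ico 1 m, (realTrigamma (k * τ) : ℂ) := by
      refine Finset.sum_congr rfl fun k hk => ?_
      have hk1 : 1 ≤ k := (Finset.mem_Ico.mp hk).1
      rw [hc, deriv_digamma_ofReal (mul_pos (by exact_mod_cast hk1) hτ)]
    rw [hsum, hc, deriv_digamma_ofReal hmτ, digamma_ofReal hmτ, doubleGammaDSeq]
    push_cast
    rfl
  -- `limUnder` has a meaningful value only now that a limit is known to exist.
  rw [show doubleGammaD τ = d from (hd'.congr' heq).limUnder_eq]
  exact hd'

/-! ### Barnes' factors as infinite products of cubic factors -/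

/-- The elementary factor `(1 + y) exp(-y + y²/2)`. -/
def cubicFactor (y : ℂ) : ℂ := (1 + y) * Complex.exp (-y + y ^ 2 / 2)

/-- The exponential removes the Taylor terms of log(1+y) up to order two. The factor is therefore
e^r with ‖r‖ ≤ ‖y‖³, and ‖e^r - 1‖ ≤ 2‖r‖ for ‖r‖ ≤ 1. -/
lemma norm_cubicFactor_sub_one_le {y : ℂ} (hy : ‖y‖ ≤ 1 / 2) :
    ‖cubicFactor y - 1‖ ≤ 2 * ‖y‖ ^ 3 := by
  have hy1 : ‖y‖ < 1 := by linarith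
  have h0 := Complex.norm_log_sub_logTaylor_le 2 hy1
  have hT : Complex.logTaylor (2 + 1) y = y - y ^ 2 / 2 := by
    simp [Complex.logTaylor, Finset.sum_range_succ]
    ring
  rw [hT] at h0
  set r := Complex.log (1 + y) - (y - y ^ 2 / 2) with hr
  have hne : 1 + y ≠ 0 := fun h => by
    have : y = -1 := by linear_combination h
    rw [this] at hy1
    simp at hy1
  have hE : cubicFactor y = Complex.exp r := by
    rw [hr, Complex.exp_sub, Complex.exp_log hne, cubicFactor,
      show -y + y ^ 2 / 2 = -(y - y ^ 2 / 2) by ring, Complex.exp_neg, ← div_eq_mul_inv]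
  have hr' : ‖r‖ ≤ ‖y‖ ^ 3 := by
    refine h0.trans ?_
    have : (1 - ‖y‖)⁻¹ ≤ 2 := by
      rw [inv_le_comm₀ (by linarith) two_pos]
      linarith
    have h3 : (0 : ℝ) ≤ ‖y‖ ^ 3 := by positivity
    norm_num
    nlinarith
  have hr1 : ‖r‖ ≤ 1 := hr'.trans (pow_le_one₀ (norm_nonneg _) hy1.le)
  rw [hE]
  exact (Complex.norm_exp_sub_one_le hr1).trans (by gcongr)

lemma sum_one_div_add_cube_le {x : ℝ} (hx : 1 ≤ x) (N : ℕ) :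
    ∑ n ∈ Finset.range N, 1 / (x + n) ^ 3 ≤ 2 / x ^ 2 := by
  have h : ∑ n ∈ Finset.range N, 1 / (x + n) ^ 3 ≤ 2 / x ^ 2 - 2 / (x + N) ^ 2 := by
    induction N with
    | zero => simp
    | succ N ih =>
      rw [Finset.sum_range_succ]
      have hy : 1 ≤ x + N := by
        have : (0 : ℝ) ≤ N := N.cast_nonneg
        linarith
      set y := x + N with hydef
      -- The telescoping step; after clearing denominators it amounts to 3y² ≥ 1.
      have : 1 / y ^ 3 ≤ 2 / y ^ 2 - 2 / (y + 1) ^ 2 := by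
        have hy0 : 0 < y := by linarith
        rw [div_sub_div _ _ (by positivity) (by positivity),
          div_le_div_iff₀ (by positivity) (by positivity)]
        have : 0 ≤ y ^ 2 * (3 * y ^ 2 - 1) := by
          have : 1 ≤ y ^ 2 := one_le_pow₀ hy
          exact mul_nonneg (by positivity) (by linarith)
        nlinarith
      have e : x + ((N + 1 : ℕ) : ℝ) = y + 1 := by push_cast; rw [hydef]; ring
      rw [e]
      linarith
  have : 0 ≤ 2 / (x + N) ^ 2 := by positivity
  linarith

/-- The factor `(Γ(x)/Γ(z+x)) exp(zψ(x) + z²ψ'(x)/2)` of Barnes' product. -/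
def barnesFactor (x : ℝ) (z : ℂ) : ℂ :=
  Complex.Gamma x / Complex.Gamma (z + x)
    * Complex.exp (z * Complex.digamma x + z ^ 2 / 2 * deriv Complex.digamma x)

/-- An exact identity for finite N, by Euler's approximants `GammaSeq`. These have N+1 linear
factors, hence the range N+1, and the ratio of the powers of N supplies the log N in the exponent.
-/
lemma prod_cubicFactor {x : ℝ} (hx : 0 < x) (z : ℂ) (hz : ∀ n : ℕ, z + x + n ≠ 0) {N : ℕ}
    (hN : N ≠ 0) :
    ∏ n ∈ Finset.range (N + 1), cubicFactor (z / (x + n))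
      = Complex.GammaSeq x N / Complex.GammaSeq (z + x) N
        * Complex.exp (z * ((Real.log N - ∑ n ∈ Finset.range (N + 1), 1 / (x + n) : ℝ) : ℂ)
          + z ^ 2 / 2 * ((∑ n ∈ Finset.range (N + 1), 1 / (x + n) ^ 2 : ℝ) : ℂ)) := by
  have hxn : ∀ n : ℕ, (x : ℂ) + n ≠ 0 := fun n h => ofReal_ne_neg_nat hx n (by
    linear_combination h)
  have hNc : (N : ℂ) ≠ 0 := Nat.cast_ne_zero.mpr hN
  have hprod : ∏ n ∈ Finset.range (N + 1), (1 + z / (x + n))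
      = (∏ n ∈ Finset.range (N + 1), (z + x + n)) / ∏ n ∈ Finset.range (N + 1), ((x : ℂ) + n) := by
    rw [← Finset.prod_div_distrib]
    refine Finset.prod_congr rfl fun n _ => ?_
    field_simp [hxn n]
    ring
  have hexp : ∏ n ∈ Finset.range (N + 1), Complex.exp (-(z / (x + n)) + (z / (x + n)) ^ 2 / 2)
      = Complex.exp (-(z * ((∑ n ∈ Finset.range (N + 1), 1 / (x + n) : ℝ) : ℂ))
          + z ^ 2 / 2 * ((∑ n ∈ Finset.range (N + 1), 1 / (x + n) ^ 2 : ℝ) : ℂ)) := by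
    rw [← Complex.exp_sum]
    congr 1
    push_cast
    rw [Finset.mul_sum, Finset.mul_sum, ← Finset.sum_neg_distrib, ← Finset.sum_add_distrib]
    refine Finset.sum_congr rfl fun n _ => ?_
    rw [div_pow]
    ring
  have hpow : (N : ℂ) ^ (z + x) = (N : ℂ) ^ (x : ℂ) * Complex.exp (z * Real.log N) := by
    rw [add_comm, Complex.cpow_add _ _ hNc, Complex.cpow_def_of_ne_zero hNc z,
      Complex.natCast_log.symm, mul_comm z]
  have h1 : ∏ n ∈ Finset.range (N + 1), (z + x + n) ≠ 0 :=
    Finset.prod_ne_zero_iff.mpr fun n _ => hz n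
  have h2 : ∏ n ∈ Finset.range (N + 1), ((x : ℂ) + n) ≠ 0 :=
    Finset.prod_ne_zero_iff.mpr fun n _ => hxn n
  have hNx : (N : ℂ) ^ (x : ℂ) ≠ 0 := by simp [Complex.cpow_eq_zero_iff, hNc]
  have hfac : (N.factorial : ℂ) ≠ 0 := Nat.cast_ne_zero.mpr N.factorial_ne_zero
  have hsplit : ∀ a b c : ℝ, Complex.exp (z * ((a - b : ℝ) : ℂ) + z ^ 2 / 2 * (c : ℂ))
      = Complex.exp (z * a) * Complex.exp (-(z * b) + z ^ 2 / 2 * c) := fun a b c => by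
    rw [← Complex.exp_add]
    congr 1
    push_cast
    ring
  have hlog := Complex.exp_ne_zero (z * Real.log N)
  simp only [cubicFactor]
  rw [Finset.prod_mul_distrib, hprod, hexp, Complex.GammaSeq, Complex.GammaSeq, hpow, hsplit]
  generalize Complex.exp (z * Real.log N) = e at hlog ⊢
  generalize Complex.exp _ = e'
  field_simp

lemma tendsto_prod_cubicFactor {x : ℝ} (hx : 0 < x) (z : ℂ) (hz : ∀ n : ℕ, z + x + n ≠ 0) :
    Tendsto (fun N : ℕ => ∏ n ∈ Finset.range (N + 1), cubicFactor (z / (x + n))) atTop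
      (𝓝 (barnesFactor x z)) := by
  have hG : Complex.Gamma (z + x) ≠ 0 := Complex.Gamma_ne_zero fun n h => hz n (by
    rw [h]; ring)
  have h1 : Tendsto (fun N : ℕ => Real.log N - ∑ n ∈ Finset.range (N + 1), 1 / (x + n)) atTop
      (𝓝 (realDigamma x)) := by
    -- The sum over range (N+1) has one term more than the limit formula for ψ; that term vanishes
    -- in the limit.
    have h0 : Tendsto (fun N : ℕ => 1 / (x + (N : ℝ))) atTop (𝓝 0) := by
      simpa [Function.comp_def] using (tendsto_inv_atTop_zero (𝕜 := ℝ)).comp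
        (tendsto_atTop_add_const_left atTop x (tendsto_natCast_atTop_atTop (R := ℝ)))
    have := (tendsto_log_sub_sum hx).sub h0
    rw [sub_zero] at this
    refine this.congr fun N => ?_
    rw [Finset.sum_range_succ]
    ring
  have h2 : Tendsto (fun N : ℕ => ∑ n ∈ Finset.range (N + 1), 1 / (x + n) ^ 2) atTop
      (𝓝 (realTrigamma x)) :=
    (summable_one_div_add_sq hx).hasSum.tendsto_sum_nat.comp (tendsto_add_atTop_nat 1)
  have h1' := (Complex.continuous_ofReal.tendsto _).comp h1
  have h2' := (Complex.continuous_ofReal.tendsto _).comp h2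
  have h3 := ((Complex.GammaSeq_tendsto_Gamma x).div (Complex.GammaSeq_tendsto_Gamma (z + x))
    hG).mul ((Complex.continuous_exp.tendsto _).comp
      ((h1'.const_mul z).add (h2'.const_mul (z ^ 2 / 2))))
  rw [barnesFactor, digamma_ofReal hx, deriv_digamma_ofReal hx]
  refine h3.congr' ?_
  filter_upwards [eventually_ne_atTop 0] with N hN
  exact (prod_cubicFactor hx z hz hN).symm

/-- Bound ∏(1+aₙ) - 1 by exp(∑‖aₙ‖) - 1 with ‖aₙ‖ ≤ 2‖z‖³/(x+n)³. The condition 2‖z‖ ≤ x puts each y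
= z/(x+n) in the range of the cubic estimate. -/
lemma norm_barnesFactor_sub_one_le {x : ℝ} (hx : 1 ≤ x) (z : ℂ) (hz : ∀ n : ℕ, z + x + n ≠ 0)
    (hzx : 2 * ‖z‖ ≤ x) :
    ‖barnesFactor x z - 1‖ ≤ Real.exp (4 * ‖z‖ ^ 3 / x ^ 2) - 1 := by
  refine le_of_tendsto ((tendsto_prod_cubicFactor (by linarith) z hz).sub_const 1).norm
    (Eventually.of_forall fun N => ?_)
  have h := Finset.norm_prod_one_add_sub_one_le (Finset.range (N + 1))
    fun n : ℕ => cubicFactor (z / (x + n)) - 1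
  simp only [add_sub_cancel] at h
  refine h.trans (sub_le_sub_right (Real.exp_le_exp.mpr ?_) 1)
  have hn : ∀ n : ℕ, ‖cubicFactor (z / (x + n)) - 1‖ ≤ 2 * ‖z‖ ^ 3 * (1 / (x + n) ^ 3) :=
    fun n => by
      have hxn : x ≤ x + n := le_add_of_nonneg_right n.cast_nonneg
      have hnorm : ‖z / ((x : ℂ) + n)‖ = ‖z‖ / (x + n) := by
        rw [norm_div, show (x : ℂ) + n = ((x + n : ℝ) : ℂ) by push_cast; rfl,
          Complex.norm_of_nonneg (by linarith)]
      refine (norm_cubicFactor_sub_one_le ?_).trans (le_of_eq ?_)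
      · rw [hnorm, div_le_iff₀ (by linarith)]
        linarith
      · rw [hnorm, div_pow]
        ring
  calc _ ≤ ∑ n ∈ Finset.range (N + 1), 2 * ‖z‖ ^ 3 * (1 / (x + n) ^ 3) :=
        Finset.sum_le_sum fun n _ => hn n
    _ ≤ 2 * ‖z‖ ^ 3 * (2 / x ^ 2) := by
        rw [← Finset.mul_sum]
        gcongr
        exact sum_one_div_add_cube_le hx _
    _ = _ := by ring

/-- At x = (j+1)τ the previous bound is e^t - 1 ≤ 2t with t = O(j⁻²), once j is large enough for the
size conditions on x and t. -/
lemma summable_barnesFactor_sub_one {τ : ℝ} (hτ : 0 < τ) (z : ℂ)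
    (hz : ∀ i j : ℕ, z + i * τ + j ≠ 0) :
    Summable fun j : ℕ => ‖barnesFactor ((j + 1) * τ) z - 1‖ := by
  set K : ℝ := 4 * ‖z‖ ^ 3 / τ ^ 2
  have hK : Summable fun j : ℕ => 2 * (K * (1 / ((j + 1 : ℕ) : ℝ) ^ 2)) :=
    (((summable_nat_add_iff 1).mpr (Real.summable_one_div_nat_pow.mpr one_lt_two)).mul_left
      K).mul_left 2
  refine Summable.of_norm_bounded_eventually_nat hK ?_
  have ht : Tendsto (fun j : ℕ => ((j : ℝ) + 1) * τ) atTop atTop :=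
    (tendsto_atTop_add_const_right _ _ tendsto_natCast_atTop_atTop).atTop_mul_const hτ
  have hsmall : Tendsto (fun j : ℕ => K * (1 / ((j + 1 : ℕ) : ℝ) ^ 2)) atTop (𝓝 0) := by
    have := hK.tendsto_atTop_zero.const_mul (1 / 2 : ℝ)
    rw [mul_zero] at this
    exact this.congr fun j => by ring
  filter_upwards [ht.eventually_ge_atTop 1, ht.eventually_ge_atTop (2 * ‖z‖),
    hsmall.eventually_le_const zero_lt_one] with j h1 h2 h3
  have hb := norm_barnesFactor_sub_one_le h1 z (fun n => by
    have := hz (j + 1) n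
    push_cast at this ⊢
    exact this) h2
  have he : 4 * ‖z‖ ^ 3 / (((j : ℝ) + 1) * τ) ^ 2 = K * (1 / ((j + 1 : ℕ) : ℝ) ^ 2) := by
    simp only [K]
    push_cast
    field_simp
  rw [he] at hb
  have hnn : 0 ≤ K * (1 / ((j + 1 : ℕ) : ℝ) ^ 2) := by positivity
  have hexp := Real.abs_exp_sub_one_le (x := K * (1 / ((j + 1 : ℕ) : ℝ) ^ 2))
    (by rwa [abs_of_nonneg hnn])
  rw [abs_of_nonneg hnn] at hexp
  rw [norm_norm]
  exact hb.trans ((le_abs_self _).trans hexp)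

/-! ### The second-order functional equation of the double gamma function -/

/-- `z` does not lie on the subgroup `ℤτ + ℤ`, which contains all zeros of `G(·; τ)`. -/
def OffLattice (τ : ℝ) (z : ℂ) : Prop := ∀ i j : ℤ, z + i * τ + j ≠ 0

lemma OffLattice.add {τ : ℝ} {z : ℂ} (hz : OffLattice τ z) (i j : ℤ) :
    OffLattice τ (z + i * τ + j) := fun i' j' h => hz (i + i') (j + j') (by
  push_cast
  linear_combination h)

lemma OffLattice.add_int {τ : ℝ} {z : ℂ} (hz : OffLattice τ z) (j : ℤ) :
    OffLattice τ (z + j) := by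
  simpa using hz.add 0 j

lemma OffLattice.add_one {τ : ℝ} {z : ℂ} (hz : OffLattice τ z) : OffLattice τ (z + 1) := by
  simpa using hz.add 0 1

lemma OffLattice.add_tau {τ : ℝ} {z : ℂ} (hz : OffLattice τ z) : OffLattice τ (z + τ) := by
  simpa using hz.add 1 0

lemma OffLattice.neg {τ : ℝ} {z : ℂ} (hz : OffLattice τ z) : OffLattice τ (-z) :=
  fun i j h => hz (-i) (-j) (by push_cast; linear_combination -h)

lemma OffLattice.ne_neg_nat {τ : ℝ} {z : ℂ} (hz : OffLattice τ z) (i n : ℕ) :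
    z + i * τ ≠ -n := fun h => hz i n (by push_cast; rw [h]; ring)

lemma OffLattice.ne_zero {τ : ℝ} {z : ℂ} (hz : OffLattice τ z) : z ≠ 0 := by
  simpa using hz 0 0

lemma OffLattice.Gamma_ne_zero {τ : ℝ} {z : ℂ} (hz : OffLattice τ z) : Complex.Gamma z ≠ 0 :=
  Complex.Gamma_ne_zero fun n => by simpa using hz.ne_neg_nat 0 n

lemma OffLattice.Gamma_add_ne_zero {τ : ℝ} {z : ℂ} (hz : OffLattice τ z) (j : ℕ) :
    Complex.Gamma (z + (((j + 1) * τ : ℝ) : ℂ)) ≠ 0 := by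
  have := (hz.add (j + 1) 0).Gamma_ne_zero
  push_cast at this ⊢
  simpa using this

/-! ### Barnes' product off the lattice and its mixed second difference -/

/-- Barnes' product `∏_{m≥1} (Γ(mτ)/Γ(z+mτ)) exp(zψ(mτ) + z²ψ'(mτ)/2)`. -/
def barnesProd (τ : ℝ) (z : ℂ) : ℂ := ∏' j : ℕ, barnesFactor ((j + 1) * τ) z

lemma doubleGamma_eq (z : ℂ) (τ : ℝ) :
    doubleGamma z τ = ((τ : ℂ) * Complex.Gamma z)⁻¹
      * Complex.exp (doubleGammaA τ * z / τ + doubleGammaB τ * z ^ 2 / (2 * (τ : ℂ) ^ 2))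
      * barnesProd τ z := by
  simp only [doubleGamma, barnesProd, barnesFactor]
  push_cast
  rfl

lemma summable_barnesFactor {τ : ℝ} (hτ : 0 < τ) {z : ℂ} (hz : OffLattice τ z) :
    Summable fun j : ℕ => ‖barnesFactor ((j + 1) * τ) z - 1‖ :=
  summable_barnesFactor_sub_one hτ z fun i j => by simpa using hz i j

lemma tendsto_barnesProd {τ : ℝ} (hτ : 0 < τ) {z : ℂ} (hz : OffLattice τ z) :
    Tendsto (fun N => ∏ j ∈ Finset.range N, barnesFactor ((j + 1) * τ) z) atTop
      (𝓝 (barnesProd τ z)) := by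
  have h := multipliable_one_add_of_summable (summable_barnesFactor hτ hz)
  simp only [add_sub_cancel] at h
  exact h.hasProd.tendsto_prod_nat

lemma barnesFactor_ne_zero {τ : ℝ} (hτ : 0 < τ) {z : ℂ} (hz : OffLattice τ z) (j : ℕ) :
    barnesFactor ((j + 1) * τ) z ≠ 0 :=
  mul_ne_zero (div_ne_zero
    (Complex.Gamma_ne_zero (ofReal_ne_neg_nat (by positivity)))
    (hz.Gamma_add_ne_zero j)) (Complex.exp_ne_zero _)

lemma barnesProd_ne_zero {τ : ℝ} (hτ : 0 < τ) {z : ℂ} (hz : OffLattice τ z) :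
    barnesProd τ z ≠ 0 := by
  have h := tprod_one_add_ne_zero_of_summable
    (f := fun j : ℕ => barnesFactor ((j + 1) * τ) z - 1)
    (fun j => by simpa using barnesFactor_ne_zero hτ hz j) (summable_barnesFactor hτ hz)
  simpa [barnesProd] using h

lemma doubleGamma_ne_zero {τ : ℝ} (hτ : 0 < τ) {z : ℂ} (hz : OffLattice τ z) :
    doubleGamma z τ ≠ 0 := by
  rw [doubleGamma_eq]
  refine mul_ne_zero (mul_ne_zero (inv_ne_zero (mul_ne_zero ?_ hz.Gamma_ne_zero))
    (Complex.exp_ne_zero _)) (barnesProd_ne_zero hτ hz)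
  exact_mod_cast hτ.ne'

/-- With x = (j+1)τ, the terms in ψ cancel, the squares leave 2τ and hence e^(τψ'(x)), and Γ(w+1) =
wΓ(w) gives the ratio (z+x)/(z+τ+x). As z+τ+x is z+x for the next j, the product telescopes. -/
lemma barnesFactor_mul {τ : ℝ} (hτ : 0 < τ) {z : ℂ} (hz : OffLattice τ z) (j : ℕ) :
    barnesFactor ((j + 1) * τ) (z + τ + 1) * barnesFactor ((j + 1) * τ) z * (z + (j + 2) * τ)
      = barnesFactor ((j + 1) * τ) (z + τ) * barnesFactor ((j + 1) * τ) (z + 1)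
        * ((z + (j + 1) * τ) * Complex.exp (τ * realTrigamma ((j + 1) * τ))) := by
  have hx : 0 < ((j : ℝ) + 1) * τ := by positivity
  have hG1 := hz.Gamma_add_ne_zero j
  have hG2 := hz.add_tau.Gamma_add_ne_zero j
  have hz1 := (hz.add (j + 1) 0).ne_zero
  have hz2 := (hz.add (j + 2) 0).ne_zero
  simp only [barnesFactor, deriv_digamma_ofReal hx]
  set x : ℝ := ((j : ℝ) + 1) * τ with hxdef
  have e1 : z + ((j : ℂ) + 1) * τ = z + x := by rw [hxdef]; push_cast; ring
  have e2 : z + ((j : ℂ) + 2) * τ = z + τ + x := by rw [hxdef]; push_cast; ring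
  push_cast at hz1 hz2
  rw [add_zero, e1] at hz1
  rw [add_zero, e2] at hz2
  rw [e1, e2, show z + τ + 1 + x = z + τ + x + 1 by ring, show z + 1 + x = z + x + 1 by ring,
    Complex.Gamma_add_one _ hz1, Complex.Gamma_add_one _ hz2]
  have hexp : Complex.exp ((z + τ + 1) * Complex.digamma x
        + (z + τ + 1) ^ 2 / 2 * realTrigamma x)
      * Complex.exp (z * Complex.digamma x + z ^ 2 / 2 * realTrigamma x)
      = Complex.exp ((z + τ) * Complex.digamma x + (z + τ) ^ 2 / 2 * realTrigamma x)
      * Complex.exp ((z + 1) * Complex.digamma x + (z + 1) ^ 2 / 2 * realTrigamma x)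
      * Complex.exp (τ * realTrigamma x) := by
    rw [← Complex.exp_add, ← Complex.exp_add, ← Complex.exp_add]
    congr 1
    ring
  generalize Complex.exp ((z + τ + 1) * Complex.digamma x + _) = a at hexp ⊢
  generalize Complex.exp (z * Complex.digamma x + _) = b at hexp ⊢
  generalize Complex.exp ((z + τ) * Complex.digamma x + _) = c at hexp ⊢
  generalize Complex.exp ((z + 1) * Complex.digamma x + _) = d at hexp ⊢
  generalize Complex.exp (τ * realTrigamma x) = e at hexp ⊢
  field_simp
  linear_combination Complex.Gamma x ^ 2 * hexp

lemma prod_barnesFactor_mul {τ : ℝ} (hτ : 0 < τ) {z : ℂ} (hz : OffLattice τ z) (N : ℕ) :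
    (∏ j ∈ Finset.range N, barnesFactor ((j + 1) * τ) (z + τ + 1))
        * (∏ j ∈ Finset.range N, barnesFactor ((j + 1) * τ) z) * (z + (N + 1) * τ)
      = (∏ j ∈ Finset.range N, barnesFactor ((j + 1) * τ) (z + τ))
        * (∏ j ∈ Finset.range N, barnesFactor ((j + 1) * τ) (z + 1))
        * ((z + τ) * Complex.exp (τ * (∑ k ∈ Finset.Ico 1 (N + 1), realTrigamma (k * τ) : ℝ))) := by
  induction N with
  | zero => simp
  | succ N ih =>
    have hz1 := (hz.add (N + 1) 0).ne_zero
    push_cast at hz1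
    rw [add_zero] at hz1
    -- z+(N+1)τ is the factor shared by the induction hypothesis and the new step.
    refine mul_right_cancel₀ hz1 ?_
    have h := barnesFactor_mul hτ hz N
    rw [Finset.sum_Ico_succ_top (by omega)]
    simp only [Finset.prod_range_succ]
    push_cast
    push_cast at ih
    rw [mul_add (τ : ℂ), Complex.exp_add]
    linear_combination (barnesFactor ((N + 1) * τ) (z + τ + 1) * barnesFactor ((N + 1) * τ) z
      * (z + (N + 2) * τ)) * ih +
      ((∏ j ∈ Finset.range N, barnesFactor ((j + 1) * τ) (z + τ))
        * (∏ j ∈ Finset.range N, barnesFactor ((j + 1) * τ) (z + 1))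
        * ((z + τ) * Complex.exp (τ * (∑ k ∈ Finset.Ico 1 (N + 1), (realTrigamma (k * τ) : ℂ))))) * h

/-- By the definition of D, τ∑ψ'(kτ) equals τD + ψ((N+1)τ) + o(1). Since ψ - log → 0, its
exponential grows like (N+1)τ e^(τD), which matches the boundary factor left by telescoping. -/
lemma tendsto_exp_sum_realTrigamma {τ : ℝ} (hτ : 0 < τ) (z : ℂ) :
    Tendsto (fun N : ℕ => Complex.exp (τ * (∑ k ∈ Finset.Ico 1 (N + 1), realTrigamma (k * τ) : ℝ))
      / (z + (N + 1) * τ)) atTop (𝓝 (Complex.exp (τ * doubleGammaD τ))) := by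
  have hNτ : Tendsto (fun N : ℕ => ((N + 1 : ℕ) : ℝ) * τ) atTop atTop :=
    (tendsto_natCast_atTop_atTop.comp (tendsto_add_atTop_nat 1)).atTop_mul_const hτ
  have hc : ∀ {u : ℝ → ℝ}, Tendsto u atTop (𝓝 0) →
      Tendsto (fun N : ℕ => (u ((N + 1 : ℕ) * τ) : ℂ)) atTop (𝓝 0) := fun {u} hu => by
    have := (Complex.continuous_ofReal.tendsto _).comp (hu.comp hNτ)
    simpa [Function.comp_def] using this
  have h1 := (tendsto_doubleGammaDSeq hτ).comp (tendsto_add_atTop_nat 1)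
  have h2 := hc tendsto_realTrigamma_atTop
  have h3 := hc tendsto_realDigamma_sub_log
  have h4 : Tendsto (fun N : ℕ => (1 : ℂ) / (1 + z * (((((N + 1 : ℕ) : ℝ) * τ)⁻¹ : ℝ) : ℂ))) atTop
      (𝓝 1) := by
    have := (tendsto_const_nhds (x := (1 : ℂ))).div
      (((hc tendsto_inv_atTop_zero).const_mul z).const_add 1) (by simp)
    rw [mul_zero, add_zero, div_one] at this
    exact this
  have h5 := ((Complex.continuous_exp.tendsto _).comp
    (((h1.const_mul (τ : ℂ)).sub (h2.const_mul (τ / 2 : ℂ))).add h3)).mul h4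
  simp only [mul_zero, sub_zero, add_zero, mul_one] at h5
  refine h5.congr fun N => ?_
  have hpos : 0 < ((N + 1 : ℕ) : ℝ) * τ := by positivity
  have hτ0 : (τ : ℂ) ≠ 0 := by exact_mod_cast hτ.ne'
  simp only [Function.comp_apply]
  have he : (τ : ℂ) * doubleGammaDSeq τ (N + 1) - τ / 2 * realTrigamma ((N + 1 : ℕ) * τ)
      + ((realDigamma ((N + 1 : ℕ) * τ) - Real.log ((N + 1 : ℕ) * τ) : ℝ) : ℂ)
      = τ * (∑ k ∈ Finset.Ico 1 (N + 1), realTrigamma (k * τ) : ℝ)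
        - Real.log ((N + 1 : ℕ) * τ) := by
    rw [doubleGammaDSeq]
    generalize ∑ k ∈ Finset.Ico 1 (N + 1), realTrigamma (k * τ) = S
    generalize realTrigamma ((N + 1 : ℕ) * τ) = t
    generalize Real.log ((N + 1 : ℕ) * τ) = l
    generalize realDigamma ((N + 1 : ℕ) * τ) = g
    push_cast
    field_simp
    ring
  rw [he, Complex.exp_sub, ← Complex.ofReal_exp (Real.log _), Real.exp_log hpos, div_mul_div_comm,
    mul_one]
  congr 1
  have hpos' : (((N + 1 : ℕ) : ℝ) : ℂ) * τ ≠ 0 := by exact_mod_cast hpos.ne'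
  push_cast at hpos' ⊢
  rw [mul_add, mul_one, mul_left_comm, mul_inv_cancel₀ hpos']
  ring

lemma barnesProd_mul {τ : ℝ} (hτ : 0 < τ) {z : ℂ} (hz : OffLattice τ z) :
    barnesProd τ (z + τ + 1) * barnesProd τ z
      = barnesProd τ (z + τ) * barnesProd τ (z + 1)
        * ((z + τ) * Complex.exp (τ * doubleGammaD τ)) := by
  refine tendsto_nhds_unique
    ((tendsto_barnesProd hτ hz.add_tau.add_one).mul (tendsto_barnesProd hτ hz))
    ((((tendsto_barnesProd hτ hz.add_tau).mul (tendsto_barnesProd hτ hz.add_one)).mul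
      ((tendsto_exp_sum_realTrigamma hτ z).const_mul (z + τ))).congr fun N => ?_)
  have hz1 := (hz.add (N + 1) 0).ne_zero
  push_cast at hz1
  rw [add_zero] at hz1
  refine mul_right_cancel₀ hz1 ?_
  rw [prod_barnesFactor_mul hτ hz N]
  generalize (∏ j ∈ Finset.range N, barnesFactor ((j + 1) * τ) (z + τ))
    * (∏ j ∈ Finset.range N, barnesFactor ((j + 1) * τ) (z + 1)) = p
  generalize Complex.exp _ = e
  generalize z + (N + 1) * (τ : ℂ) = w at hz1 ⊢
  field_simp

/-- `G(z+τ+1) G(z) = (z/τ) G(z+τ) G(z+1)`. -/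
theorem doubleGamma_add_add_mul {τ : ℝ} (hτ : 0 < τ) {z : ℂ} (hz : OffLattice τ z) :
    doubleGamma (z + τ + 1) τ * doubleGamma z τ
      = z / τ * (doubleGamma (z + τ) τ * doubleGamma (z + 1) τ) := by
  have hτ0 : (τ : ℂ) ≠ 0 := by exact_mod_cast hτ.ne'
  have hlog : Complex.exp (Real.log τ) = τ := by
    rw [← Complex.ofReal_exp, Real.exp_log hτ]
  -- The linear exponent ã cancels; the quadratic one leaves b̃/τ = -log τ - τD, which e^(τD)·τ
  -- compensates. The remaining z/(z+τ) from 1/Γ meets the z+τ of `barnesProd_mul`.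
  have hexp : Complex.exp (doubleGammaA τ * (z + τ + 1) / τ
          + doubleGammaB τ * (z + τ + 1) ^ 2 / (2 * (τ : ℂ) ^ 2))
      * Complex.exp (doubleGammaA τ * z / τ + doubleGammaB τ * z ^ 2 / (2 * (τ : ℂ) ^ 2))
      * Complex.exp (τ * doubleGammaD τ) * τ
      = Complex.exp (doubleGammaA τ * (z + τ) / τ
          + doubleGammaB τ * (z + τ) ^ 2 / (2 * (τ : ℂ) ^ 2))
      * Complex.exp (doubleGammaA τ * (z + 1) / τ
          + doubleGammaB τ * (z + 1) ^ 2 / (2 * (τ : ℂ) ^ 2)) := by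
    conv_lhs => rw [← hlog]
    simp only [← Complex.exp_add]
    rw [hlog]
    congr 1
    rw [doubleGammaB]
    push_cast
    field_simp
    ring
  have hP := barnesProd_mul hτ hz
  have hz0 := hz.ne_zero
  have hzτ0 := hz.add_tau.ne_zero
  have hG := hz.Gamma_ne_zero
  have hGτ := hz.add_tau.Gamma_ne_zero
  simp only [doubleGamma_eq]
  rw [Complex.Gamma_add_one _ hz0, Complex.Gamma_add_one _ hzτ0]
  generalize Complex.exp (doubleGammaA τ * (z + τ + 1) / τ + _) = a at hexp ⊢
  generalize Complex.exp (doubleGammaA τ * z / τ + _) = b at hexp ⊢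
  generalize Complex.exp (doubleGammaA τ * (z + τ) / τ + _) = c at hexp ⊢
  generalize Complex.exp (doubleGammaA τ * (z + 1) / τ + _) = d at hexp ⊢
  generalize Complex.exp (τ * doubleGammaD τ) = e at hexp hP
  field_simp
  linear_combination a * b * τ * hP + barnesProd τ (z + τ) * barnesProd τ (z + 1) * (z + τ) * hexp

/-! ### Ratios of double gamma functions and of kernels -/

lemma doubleGamma_ratio {τ : ℝ} (hτ : 0 < τ) {v : ℂ} (hv : OffLattice τ v) :
    doubleGamma (v + τ + 1) τ * doubleGamma v τ
      / (doubleGamma (v + 1) τ * doubleGamma (v + τ) τ) = v / τ := by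
  rw [doubleGamma_add_add_mul hτ hv, mul_comm (doubleGamma (v + 1) τ)]
  exact mul_div_cancel_right₀ _ (mul_ne_zero (doubleGamma_ne_zero hτ hv.add_tau)
    (doubleGamma_ne_zero hτ hv.add_one))

lemma doubleGamma_ratio_nat {τ : ℝ} (hτ : 0 < τ) {v : ℂ} (hv : OffLattice τ v) (k : ℕ) :
    doubleGamma (v + k + τ) τ * doubleGamma v τ
      / (doubleGamma (v + k) τ * doubleGamma (v + τ) τ)
      = (∏ j ∈ Finset.range k, (v + j)) / (τ : ℂ) ^ k := by
  induction k with
  | zero =>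
    have h1 := doubleGamma_ne_zero hτ hv
    have h2 := doubleGamma_ne_zero hτ hv.add_tau
    simp only [Nat.cast_zero, add_zero, Finset.range_zero, Finset.prod_empty, pow_zero]
    rw [mul_comm, div_self (mul_ne_zero h1 h2), div_one]
  | succ k ih =>
    have hvk : OffLattice τ (v + k) := by simpa using hv.add_int k
    have h := doubleGamma_ratio hτ hvk
    have h1 := doubleGamma_ne_zero hτ hvk
    have h2 := doubleGamma_ne_zero hτ hvk.add_tau
    rw [Finset.prod_range_succ, pow_succ]
    refine Eq.trans ?_ (mul_div_mul_comm _ _ _ _).symm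
    rw [← ih, ← h, Nat.cast_succ,
      show v + (k + 1 : ℂ) + τ = v + k + τ + 1 by ring, ← add_assoc]
    field_simp

/-- The falling factorial `u (u - 1) ⋯ (u - k + 1)`. -/
def fallingFactorial (u : ℂ) (k : ℕ) : ℂ := ∏ j ∈ Finset.range k, (u - j)

/-- Apply `doubleGamma_ratio_nat` at v = 1+u-k, where v(v+1)⋯(v+k-1) is the falling factorial of u
read backwards. -/
lemma doubleGamma_ratio_falling {τ : ℝ} (hτ : 0 < τ) {u : ℂ} (hu : OffLattice τ u) (k : ℕ) :
    (τ : ℂ) ^ k * (doubleGamma (1 + u + τ) τ * doubleGamma (1 + u - k) τ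
      / (doubleGamma (1 + u) τ * doubleGamma (1 + u - k + τ) τ)) = fallingFactorial u k := by
  have hv : OffLattice τ (1 + u - k) := by
    have := hu.add_int (1 - k)
    push_cast at this
    rwa [show u + (1 - (k : ℂ)) = 1 + u - k by ring] at this
  have h := doubleGamma_ratio_nat hτ hv k
  have hτ0 : (τ : ℂ) ≠ 0 := by exact_mod_cast hτ.ne'
  rw [sub_add_cancel] at h
  rw [h, mul_div_cancel₀ _ (pow_ne_zero k hτ0), fallingFactorial, ← Finset.prod_range_reflect]
  refine Finset.prod_congr rfl fun j hj => ?_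
  have hj' := Finset.mem_range.mp hj
  rw [Nat.cast_sub (by omega), Nat.cast_sub (by omega)]
  push_cast
  ring

/-- Here v = -u: the rising factorial of -u is (-1)^k times the falling factorial of u. This is the
source of (-τ)^k when the new pairs enter with +σs. -/
lemma doubleGamma_ratio_rising {τ : ℝ} (hτ : 0 < τ) {u : ℂ} (hu : OffLattice τ u) (k : ℕ) :
    (-(τ : ℂ)) ^ k * (doubleGamma (-u + k + τ) τ * doubleGamma (-u) τ
      / (doubleGamma (-u + k) τ * doubleGamma (-u + τ) τ)) = fallingFactorial u k := by
  have hτ0 : (τ : ℂ) ≠ 0 := by exact_mod_cast hτ.ne'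
  rw [doubleGamma_ratio_nat hτ hu.neg k, neg_pow, mul_assoc, mul_div_cancel₀ _ (pow_ne_zero k hτ0),
    fallingFactorial, ← Finset.card_range k, ← Finset.prod_const, Finset.card_range,
    ← Finset.prod_mul_distrib]
  exact Finset.prod_congr rfl fun j _ => by ring

/-! ### Adjoining parameters to the kernel -/

lemma foxBarnesKernel_append_left (τ : ℝ) {m : ℕ} (n : ℕ) (X A B Y : List (ℂ × ℝ)) {l : ℕ}
    (hl : X.length = l) (hm : m ≤ B.length) (s : ℂ) :
    foxBarnesKernel τ m (n + l) (X ++ A) (B ++ Y) s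
      = ((X.map fun x => doubleGamma (1 + τ - x.1 - x.2 * s) τ).prod
        / (Y.map fun x => doubleGamma (1 + τ - x.1 - x.2 * s) τ).prod)
        * foxBarnesKernel τ m n A B s := by
  subst hl
  rw [add_comm n]
  simp only [foxBarnesKernel, List.take_append_of_le_length hm, List.drop_append_of_le_length hm,
    List.take_length_add_append, List.drop_length_add_append, List.map_append, List.prod_append]
  rw [div_mul_div_comm]
  congr 1 <;> ring

lemma foxBarnesKernel_append_right (τ : ℝ) (m : ℕ) {n : ℕ} (X A B Y : List (ℂ × ℝ)) {l : ℕ}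
    (hl : X.length = l) (hn : n ≤ A.length) (s : ℂ) :
    foxBarnesKernel τ (m + l) n (A ++ Y) (X ++ B) s
      = ((X.map fun x => doubleGamma (x.1 + x.2 * s) τ).prod
        / (Y.map fun x => doubleGamma (x.1 + x.2 * s) τ).prod)
        * foxBarnesKernel τ m n A B s := by
  subst hl
  rw [add_comm m]
  simp only [foxBarnesKernel, List.take_append_of_le_length hn, List.drop_append_of_le_length hn,
    List.take_length_add_append, List.drop_length_add_append, List.map_append, List.prod_append]
  rw [div_mul_div_comm]
  congr 1 <;> ring

/-- Shifting all first parameters by `ρ` times the second ones amounts to a shift of the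
variable. -/
lemma foxBarnesKernel_shift (τ : ℝ) (m n : ℕ) (A B : List (ℂ × ℝ)) (ρ s : ℂ) :
    foxBarnesKernel τ m n (A.map fun x => (x.1 + x.2 * ρ, x.2)) (B.map fun x => (x.1 + x.2 * ρ, x.2))
      (s - ρ) = foxBarnesKernel τ m n A B s := by
  have h1 : ∀ x : ℂ × ℝ, x.1 + x.2 * ρ + x.2 * (s - ρ) = x.1 + x.2 * s := fun x => by ring
  have h2 : ∀ x : ℂ × ℝ, 1 + τ - (x.1 + x.2 * ρ) - x.2 * (s - ρ) = 1 + τ - x.1 - x.2 * s :=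
    fun x => by ring
  simp only [foxBarnesKernel, ← List.map_take, ← List.map_drop, List.map_map, Function.comp_def,
    h1, h2]

/-- Each lattice condition fixes C.path t, hence t by injectivity; countably many values of t are a
null set. -/
lemma MBContour.ae_offLattice (C : MBContour) (τ : ℝ) (a : ℂ) {b : ℂ} (hb : b ≠ 0) :
    ∀ᵐ t : ℝ, OffLattice τ (a + b * C.path t) := by
  have hcount : (⋃ p : ℤ × ℤ, {t : ℝ | a + b * C.path t + p.1 * τ + p.2 = 0}).Countable := by
    refine Set.countable_iUnion fun p => Set.Subsingleton.countable fun t ht t' ht' => ?_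
    refine C.injective_path (mul_left_cancel₀ hb ?_)
    simp only [Set.mem_ofPred_eq] at ht ht'
    linear_combination ht - ht'
  filter_upwards [hcount.ae_notMem MeasureTheory.volume] with t ht i j h
  exact ht (Set.mem_iUnion.mpr ⟨(i, j), h⟩)

/-! ### Differentiation of exponential contour integrals -/

section ExpIntegral

variable {s h : ℝ → ℂ}

/-- The integral `(2πi)⁻¹ ∫ h(t) e^{-s(t)w} dt`. -/
def expIntegral (s h : ℝ → ℂ) (w : ℂ) : ℂ :=
  (2 * Real.pi * Complex.I)⁻¹ * ∫ t : ℝ, h t * Complex.exp (-(s t * w))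

/-- Absolute convergence of `∫ h(t) e^{-s(t)w} dt`. -/
def ExpIntegrable (s h : ℝ → ℂ) (w : ℂ) : Prop :=
  MeasureTheory.Integrable fun t : ℝ => h t * Complex.exp (-(s t * w))

/-- Measurability of h is not assumed; it enters through integrability at one point, and changing w
multiplies by a continuous function. -/
lemma ExpIntegrable.aestronglyMeasurable (hs : Continuous s) {w₀ : ℂ}
    (hi : ExpIntegrable s h w₀) (w : ℂ) :
    MeasureTheory.AEStronglyMeasurable (fun t : ℝ => h t * Complex.exp (-(s t * w))) := by
  have hc : Continuous fun t => Complex.exp (s t * (w₀ - w)) := by fun_prop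
  refine ((MeasureTheory.Integrable.aestronglyMeasurable hi).mul hc.aestronglyMeasurable).congr
    (Eventually.of_forall fun t => ?_)
  simp only [Pi.mul_apply]
  rw [mul_assoc, ← Complex.exp_add]
  ring_nf

/-- One of ±Re s, ±Im s is at least ‖s‖/2. So exponential growth in ‖s‖ is controlled by moving w a
distance r in four directions. -/
lemma exp_half_norm_le (s : ℂ) {r : ℝ} (hr : 0 ≤ r) :
    Real.exp (‖s‖ * r / 2) ≤ Real.exp (-(s * r).re) + Real.exp (-(s * -r).re)
      + Real.exp (-(s * (r * Complex.I)).re) + Real.exp (-(s * -(r * Complex.I)).re) := by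
  have hn := Complex.norm_le_abs_re_add_abs_im s
  have e1 : (s * r).re = s.re * r := by simp
  have e2 : (s * -r).re = -(s.re * r) := by simp
  have e3 : (s * (r * Complex.I)).re = -(s.im * r) := by simp
  have e4 : (s * -(r * Complex.I)).re = s.im * r := by simp
  rw [e1, e2, e3, e4, neg_neg, neg_neg]
  have p1 := Real.exp_pos (-(s.re * r))
  have p2 := Real.exp_pos (s.re * r)
  have p3 := Real.exp_pos (s.im * r)
  have p4 := Real.exp_pos (-(s.im * r))
  have key : ‖s‖ * r / 2 ≤ max |s.re| |s.im| * r := by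
    have : ‖s‖ ≤ 2 * max |s.re| |s.im| := by
      linarith [le_max_left |s.re| |s.im|, le_max_right |s.re| |s.im|]
    nlinarith
  refine (Real.exp_le_exp.mpr key).trans ?_
  rcases max_cases |s.re| |s.im| with ⟨h, _⟩ | ⟨h, _⟩ <;> rw [h]
  · rcases abs_cases s.re with ⟨h, _⟩ | ⟨h, _⟩ <;> rw [h]
    · linarith
    · rw [neg_mul]
      linarith
  · rcases abs_cases s.im with ⟨h, _⟩ | ⟨h, _⟩ <;> rw [h]
    · linarith
    · rw [neg_mul]
      linarith

lemma hasDerivAt_expIntegral_aux (hs : Continuous s) {w₀ : ℂ}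
    (hi : ∀ᶠ w in 𝓝 w₀, ExpIntegrable s h w) :
    ExpIntegrable s (fun t => s t * h t) w₀ ∧
      HasDerivAt (expIntegral s h) (-expIntegral s (fun t => s t * h t) w₀) w₀ := by
  obtain ⟨r, hr, hball⟩ := Metric.eventually_nhds_iff_ball.mp hi
  set R : ℝ := r / 2 with hR
  have hRpos : 0 < R := by positivity
  have hmem : ∀ δ : ℂ, ‖δ‖ = R → ExpIntegrable s h (w₀ + δ) := fun δ hδ => hball _ (by
    rw [Metric.mem_ball, dist_eq_norm, add_sub_cancel_left, hδ]
    linarith)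
  have hRn : ‖(R : ℂ)‖ = R := Complex.norm_of_nonneg hRpos.le
  have hI : ‖(R : ℂ) * Complex.I‖ = R := by rw [norm_mul, hRn, Complex.norm_I, mul_one]
  have hi₀ : ExpIntegrable s h w₀ := hi.self_of_nhds
  -- For ‖w-w₀‖ ≤ R/4, moving w costs e^(‖s‖R/4) and the extra factor ‖s‖ costs (4/R)e^(‖s‖R/4).
  -- Together they give (4/R)e^(‖s‖R/2), which the integrands at w₀ ± R and w₀ ± iR dominate.
  let bound : ℝ → ℝ := fun t => 4 / R *
    (‖h t * Complex.exp (-(s t * (w₀ + R)))‖ + ‖h t * Complex.exp (-(s t * (w₀ + -R)))‖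
      + ‖h t * Complex.exp (-(s t * (w₀ + R * Complex.I)))‖
      + ‖h t * Complex.exp (-(s t * (w₀ + -(R * Complex.I))))‖)
  have hbound : MeasureTheory.Integrable bound :=
    ((((hmem R hRn).norm.add (hmem (-R) (by rwa [norm_neg])).norm).add
      (hmem (R * Complex.I) hI).norm).add
      (hmem (-(R * Complex.I)) (by rwa [norm_neg])).norm).const_mul (4 / R)
  have hmain := hasDerivAt_integral_of_dominated_loc_of_deriv_le
    (μ := MeasureTheory.volume) (F := fun w (t : ℝ) => h t * Complex.exp (-(s t * w)))
    (F' := fun w (t : ℝ) => -(s t * h t * Complex.exp (-(s t * w))))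
    (x₀ := w₀) (bound := bound) (Metric.ball_mem_nhds w₀ (by positivity : 0 < R / 4))
    (Eventually.of_forall fun w => hi₀.aestronglyMeasurable hs w) hi₀
    (by
      have := (hs.aestronglyMeasurable.mul (hi₀.aestronglyMeasurable hs w₀)).neg
      refine this.congr (Eventually.of_forall fun t => ?_)
      simp only [Pi.neg_apply, Pi.mul_apply, mul_assoc])
    (Eventually.of_forall fun t w hw => ?_) hbound (Eventually.of_forall fun t w hw => ?_)
  · obtain ⟨h1, h2⟩ := hmain
    refine ⟨by simpa using! h1.neg, ?_⟩
    have := h2.const_mul (2 * Real.pi * Complex.I)⁻¹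
    rw [MeasureTheory.integral_neg, mul_neg] at this
    exact this
  · have hw' : ‖w - w₀‖ ≤ R / 4 := by
      rw [← dist_eq_norm]
      exact (Metric.mem_ball.mp hw).le
    have hn : ∀ w : ℂ, ‖Complex.exp (-(s t * (w₀ + w)))‖
        = Real.exp (-(s t * w₀).re) * Real.exp (-(s t * w).re) := fun w => by
      rw [Complex.norm_exp, ← Real.exp_add]
      congr 1
      rw [mul_add, Complex.neg_re, Complex.add_re]
      ring
    have hexp : ‖Complex.exp (-(s t * w))‖
        ≤ Real.exp (-(s t * w₀).re) * Real.exp (‖s t‖ * R / 4) := by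
      rw [show w = w₀ + (w - w₀) by ring, hn]
      gcongr
      calc -(s t * (w - w₀)).re ≤ ‖s t * (w - w₀)‖ :=
            (neg_le_abs _).trans (Complex.abs_re_le_norm _)
        _ ≤ ‖s t‖ * R / 4 := by
            rw [norm_mul, mul_div_assoc]
            gcongr
    have hlin : ‖s t‖ ≤ 4 / R * Real.exp (‖s t‖ * R / 4) := by
      have h0 : ‖s t‖ * R / 4 ≤ Real.exp (‖s t‖ * R / 4) := by
        linarith [Real.add_one_le_exp (‖s t‖ * R / 4)]
      calc ‖s t‖ = 4 / R * (‖s t‖ * R / 4) := by field_simp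
        _ ≤ _ := by gcongr
    have hsq : Real.exp (‖s t‖ * R / 4) * Real.exp (‖s t‖ * R / 4)
        = Real.exp (‖s t‖ * R / 2) := by
      rw [← Real.exp_add]
      ring_nf
    simp only [bound, norm_neg, norm_mul, hn]
    calc ‖s t‖ * ‖h t‖ * ‖Complex.exp (-(s t * w))‖
        ≤ (4 / R * Real.exp (‖s t‖ * R / 4)) * ‖h t‖
            * (Real.exp (-(s t * w₀).re) * Real.exp (‖s t‖ * R / 4)) := by gcongr
      _ = 4 / R * (‖h t‖ * Real.exp (-(s t * w₀).re)) * Real.exp (‖s t‖ * R / 2) := by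
          rw [← hsq]
          ring
      _ ≤ 4 / R * (‖h t‖ * Real.exp (-(s t * w₀).re)) * (Real.exp (-(s t * R).re)
          + Real.exp (-(s t * -R).re) + Real.exp (-(s t * (R * Complex.I)).re)
          + Real.exp (-(s t * -(R * Complex.I)).re)) := by
          gcongr
          exact exp_half_norm_le _ hRpos.le
      _ = _ := by ring
  · have := (((hasDerivAt_id w).const_mul (s t)).fun_neg.cexp).const_mul (h t)
    simp only [id_eq, mul_one] at this
    refine this.congr_deriv ?_
    ring

lemma hasDerivAt_expIntegral (hs : Continuous s) {w₀ : ℂ}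
    (hi : ∀ᶠ w in 𝓝 w₀, ExpIntegrable s h w) :
    ∀ᶠ w in 𝓝 w₀, ExpIntegrable s (fun t => s t * h t) w ∧
      HasDerivAt (expIntegral s h) (-expIntegral s (fun t => s t * h t) w) w :=
  hi.eventually_nhds.mono fun _ hw => hasDerivAt_expIntegral_aux hs hw

lemma ExpIntegrable.affine {w : ℂ} (h0 : ExpIntegrable s h w)
    (h1 : ExpIntegrable s (fun t => s t * h t) w) (a b : ℂ) :
    ExpIntegrable s (fun t => (a - b * s t) * h t) w ∧
    expIntegral s (fun t => (a - b * s t) * h t) w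
      = a * expIntegral s h w - b * expIntegral s (fun t => s t * h t) w := by
  have e : (fun t => (a - b * s t) * h t * Complex.exp (-(s t * w)))
      = fun t => a * (h t * Complex.exp (-(s t * w)))
        - b * (s t * h t * Complex.exp (-(s t * w))) := by
    ext t
    ring
  have i0 := MeasureTheory.Integrable.const_mul h0 a
  have i1 := MeasureTheory.Integrable.const_mul h1 b
  refine ⟨?_, ?_⟩
  · rw [ExpIntegrable, e]
    exact i0.sub i1
  · rw [expIntegral, e, MeasureTheory.integral_sub i0 i1, MeasureTheory.integral_const_mul,
      MeasureTheory.integral_const_mul, expIntegral, expIntegral]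
    ring

/-! ### Derivatives along a branch of the logarithm -/

variable {L : ℂ → ℂ} {z : ℂ}

/-- The function `e^{ωL(x)} (2πi)⁻¹ ∫ h(t) e^{-b s(t) L(x)} dt`, that is, the contour integral of
`h(t) y^{ω - b s(t)}` at `y = e^{L(x)}`. -/
def powerIntegral (s : ℝ → ℂ) (L : ℂ → ℂ) (b ω : ℂ) (h : ℝ → ℂ) (x : ℂ) : ℂ :=
  Complex.exp (ω * L x) * expIntegral s h (b * L x)

/-- Differentiate e^L = cx+d. Writing L' with e^(-L) turns the division by cx+d into the shift ω →
ω-1. -/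
lemma IsLogBranchAt.hasDerivAt {c d : ℂ} (hL : IsLogBranchAt L (fun x => c * x + d) z) :
    ∀ᶠ x in 𝓝 z, HasDerivAt L (c * Complex.exp (-L x)) x := by
  filter_upwards [hL.1.eventually_analyticAt, hL.2.eventually_nhds] with x hx hx'
  have h1 := hx.differentiableAt.hasDerivAt
  have h2 : HasDerivAt (fun y => c * y + d) c x := by
    simpa using ((hasDerivAt_id x).const_mul c).add_const d
  have h3 := h1.cexp.unique (h2.congr_of_eventuallyEq hx')
  refine h1.congr_deriv ?_
  rw [← h3, mul_comm (Complex.exp (L x)), mul_assoc, ← Complex.exp_add, add_neg_cancel,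
    Complex.exp_zero, mul_one]

lemma ExpIntegrable.eventually_affine (hs : Continuous s) {w₀ : ℂ}
    (hi : ∀ᶠ w in 𝓝 w₀, ExpIntegrable s h w) (a b : ℂ) :
    ∀ᶠ w in 𝓝 w₀, ExpIntegrable s (fun t => (a - b * s t) * h t) w := by
  filter_upwards [hi, hasDerivAt_expIntegral hs hi] with w h0 h1
  exact (h0.affine h1.1 a b).1

lemma IsLogBranchAt.hasDerivAt_powerIntegral {c d b : ℂ} (hs : Continuous s)
    (hL : IsLogBranchAt L (fun x => c * x + d) z) (ω : ℂ)
    (hi : ∀ᶠ w in 𝓝 (b * L z), ExpIntegrable s h w) :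
    ∀ᶠ x in 𝓝 z, HasDerivAt (powerIntegral s L b ω h)
      (c * powerIntegral s L b (ω - 1) (fun t => (ω - b * s t) * h t) x) x := by
  have hcont : Tendsto (fun x => b * L x) (𝓝 z) (𝓝 (b * L z)) :=
    (hL.1.continuousAt.tendsto).const_mul b
  filter_upwards [hL.hasDerivAt, hcont.eventually (hi.and (hasDerivAt_expIntegral hs hi))]
    with x hx ⟨h0, h1, hd⟩
  have h2 := (h0.affine h1 ω b).2
  have h3 := (hx.const_mul ω).cexp.mul (hd.comp x (hx.const_mul b))
  refine h3.congr_deriv ?_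
  rw [powerIntegral, h2, sub_mul, one_mul, sub_eq_add_neg (ω * L x), Complex.exp_add,
    Function.comp_apply]
  ring

lemma IsLogBranchAt.analyticAt_powerIntegral {c d b : ℂ} (hs : Continuous s)
    (hL : IsLogBranchAt L (fun x => c * x + d) z) (ω : ℂ)
    (hi : ∀ᶠ w in 𝓝 (b * L z), ExpIntegrable s h w) :
    AnalyticAt ℂ (powerIntegral s L b ω h) z :=
  Complex.analyticAt_iff_eventually_differentiableAt.mpr
    ((hL.hasDerivAt_powerIntegral hs ω hi).mono fun _ hx => hx.differentiableAt)

/-- Both claims are kept on neighbourhoods so that the induction can differentiate again. -/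
lemma IsLogBranchAt.iteratedDeriv_powerIntegral {c d b : ℂ} (hs : Continuous s)
    (hL : IsLogBranchAt L (fun x => c * x + d) z) (ω : ℂ)
    (hi : ∀ᶠ w in 𝓝 (b * L z), ExpIntegrable s h w) (k : ℕ) :
    (∀ᶠ w in 𝓝 (b * L z), ExpIntegrable s (fun t => fallingFactorial (ω - b * s t) k * h t) w) ∧
    ∀ᶠ x in 𝓝 z, iteratedDeriv k (powerIntegral s L b ω h) x
      = c ^ k * powerIntegral s L b (ω - k) (fun t => fallingFactorial (ω - b * s t) k * h t) x := by
  induction k with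
  | zero => simpa [fallingFactorial] using hi
  | succ k ih =>
    obtain ⟨ih1, ih2⟩ := ih
    have e : (fun t => fallingFactorial (ω - b * s t) (k + 1) * h t)
        = fun t => (ω - k - b * s t) * (fallingFactorial (ω - b * s t) k * h t) := by
      ext t
      rw [fallingFactorial, Finset.prod_range_succ, ← fallingFactorial]
      ring
    rw [e]
    refine ⟨ExpIntegrable.eventually_affine hs ih1 _ _, ?_⟩
    filter_upwards [ih2.eventually_nhds, hL.hasDerivAt_powerIntegral hs (ω - k) ih1] with x h1 h2
    rw [iteratedDeriv_succ, Filter.EventuallyEq.deriv_eq h1, (h2.const_mul (c ^ k)).deriv,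
      Nat.cast_succ, pow_succ, sub_sub]
    ring

lemma IsLogBranchAt.foldr_eulerOp_powerIntegral {b : ℂ} (hs : Continuous s)
    (hL : IsLogBranchAt L (fun x => x) z) (ω : ℂ)
    (hi : ∀ᶠ w in 𝓝 (b * L z), ExpIntegrable s h w) (cs : List ℂ) :
    (∀ᶠ w in 𝓝 (b * L z),
      ExpIntegrable s (fun t => (cs.map fun a => ω - b * s t - a).prod * h t) w) ∧
    ∀ᶠ x in 𝓝 z, cs.foldr eulerOp (powerIntegral s L b ω h) x
      = powerIntegral s L b ω (fun t => (cs.map fun a => ω - b * s t - a).prod * h t) x := by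
  have hL' : IsLogBranchAt L (fun x => 1 * x + 0) z := by simpa using hL
  induction cs with
  | nil => simpa using hi
  | cons a cs ih =>
    obtain ⟨ih1, ih2⟩ := ih
    have e : (fun t => ((a :: cs).map fun a => ω - b * s t - a).prod * h t)
        = fun t => ((ω - a) - b * s t) * ((cs.map fun a => ω - b * s t - a).prod * h t) := by
      ext t
      rw [List.map_cons, List.prod_cons]
      ring
    rw [e]
    set g : ℝ → ℂ := fun t => (cs.map fun a => ω - b * s t - a).prod * h t
    refine ⟨ExpIntegrable.eventually_affine hs ih1 _ _, ?_⟩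
    have hcont : Tendsto (fun x => b * L x) (𝓝 z) (𝓝 (b * L z)) :=
      (hL.1.continuousAt.tendsto).const_mul b
    filter_upwards [ih2.eventually_nhds, hL'.hasDerivAt_powerIntegral hs ω ih1, hL.2,
      hcont.eventually (ih1.and (hasDerivAt_expIntegral hs ih1))] with x h1 h2 h3 ⟨h4, h5, _⟩
    -- The factor z of the Euler operator restores the exponent that the derivative lowered, so ω
    -- stays fixed.
    have hexp : Complex.exp ((ω - 1) * L x) * Complex.exp (L x) = Complex.exp (ω * L x) := by
      rw [← Complex.exp_add]
      ring_nf
    rw [List.foldr_cons, eulerOp, Filter.EventuallyEq.deriv_eq h1, h2.deriv, h1.self_of_nhds,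
      powerIntegral, powerIntegral, powerIntegral, (h4.affine h5 _ _).2, (h4.affine h5 _ _).2,
      ← hexp, h3]
    ring

end ExpIntegral

/-! ### Fox-Barnes functions as exponential integrals -/

/-- The integrand of the Fox-Barnes function without the factor `Z^{-s}`. -/
def foxBarnesWeight (τ : ℝ) (ε : ℂ) (m n : ℕ) (A B : List (ℂ × ℝ)) (C : MBContour) (t : ℝ) : ℂ :=
  foxBarnesKernel τ m n A B (C.path t) * Complex.exp (Real.pi * ε * C.path t ^ 2 / τ)
    * deriv C.path t

lemma foxBarnesIntegrand_mul (τ : ℝ) (ε : ℂ) (m n : ℕ) (A B : List (ℂ × ℝ)) (C : MBContour)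
    (w : ℂ) (t : ℝ) :
    foxBarnesIntegrand τ ε m n A B w (C.path t) * deriv C.path t
      = foxBarnesWeight τ ε m n A B C t * Complex.exp (-(C.path t * w)) := by
  rw [foxBarnesIntegrand, foxBarnesWeight]
  ring

lemma foxBarnesConverges_iff (τ : ℝ) (ε : ℂ) (m n : ℕ) (A B : List (ℂ × ℝ)) (C : MBContour)
    (w : ℂ) :
    FoxBarnesConverges τ ε m n A B C w
      ↔ ExpIntegrable C.path (foxBarnesWeight τ ε m n A B C) w := by
  simp only [FoxBarnesConverges, ExpIntegrable, foxBarnesIntegrand_mul]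

lemma foxBarnesI_eq (τ : ℝ) (ε : ℂ) (m n : ℕ) (A B : List (ℂ × ℝ)) (C : MBContour) (w : ℂ) :
    foxBarnesI τ ε m n A B C w = expIntegral C.path (foxBarnesWeight τ ε m n A B C) w := by
  simp only [foxBarnesI, expIntegral, foxBarnesIntegrand_mul]

lemma exp_mul_foxBarnesI_eq (τ : ℝ) (ε : ℂ) (m n : ℕ) (A B : List (ℂ × ℝ)) (C : MBContour)
    (ω b : ℂ) (L : ℂ → ℂ) :
    (fun x => Complex.exp (ω * L x) * foxBarnesI τ ε m n A B C (b * L x))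
      = powerIntegral C.path L b ω (foxBarnesWeight τ ε m n A B C) := by
  ext x
  rw [foxBarnesI_eq, powerIntegral]

/-- If multiplication of the kernel by `q` gives `κ` times the kernel with other parameters off a
countable set, then the corresponding integrals agree. -/
lemma foxBarnes_of_kernel_eq {ι : Type*} [Countable ι] {τ : ℝ} {ε : ℂ} {m n m' n' : ℕ} {A B A' B' : List (ℂ × ℝ)}
    {C : MBContour} {w b κ : ℂ} {q : ℂ → ℂ} (u : ι → ℂ) (hb : b ≠ 0) (hκ : κ ≠ 0)
    (hq : ∀ s, (∀ i, OffLattice τ (u i - b * s)) →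
      κ * foxBarnesKernel τ m' n' A' B' s = q s * foxBarnesKernel τ m n A B s)
    (hi : ExpIntegrable C.path (fun t => q (C.path t) * foxBarnesWeight τ ε m n A B C t) w) :
    FoxBarnesConverges τ ε m' n' A' B' C w ∧
      expIntegral C.path (fun t => q (C.path t) * foxBarnesWeight τ ε m n A B C t) w
        = κ * foxBarnesI τ ε m' n' A' B' C w := by
  have hae : (fun t => q (C.path t) * foxBarnesWeight τ ε m n A B C t
        * Complex.exp (-(C.path t * w)))
      =ᵐ[MeasureTheory.volume] fun t => κ * (foxBarnesWeight τ ε m' n' A' B' C t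
        * Complex.exp (-(C.path t * w))) := by
    filter_upwards [eventually_countable_forall.mpr fun i =>
      C.ae_offLattice τ (u i) (neg_ne_zero.mpr hb)] with t ht
    have := hq (C.path t) fun i => by simpa only [neg_mul, ← sub_eq_add_neg] using ht i
    rw [foxBarnesWeight, foxBarnesWeight]
    linear_combination -(Complex.exp (Real.pi * ε * C.path t ^ 2 / τ)
      * deriv C.path t * Complex.exp (-(C.path t * w))) * this
  refine ⟨?_, ?_⟩
  · rw [foxBarnesConverges_iff, ExpIntegrable]
    have h := (MeasureTheory.Integrable.congr hi hae).const_mul κ⁻¹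
    simpa only [inv_mul_cancel_left₀ hκ] using h
  · rw [foxBarnesI_eq, expIntegral, MeasureTheory.integral_congr_ae hae,
      MeasureTheory.integral_const_mul, expIntegral, mul_left_comm]

/-- Translation of the contour. -/
lemma foxBarnesIntegrand_translate {τ : ℝ} (hτ : τ ≠ 0) (ε : ℂ) (m n : ℕ) (A B : List (ℂ × ℝ))
    (C : MBContour) (w ρ : ℂ) (t : ℝ) :
    foxBarnesIntegrand τ ε m n (A.map fun x => (x.1 + x.2 * ρ, x.2))
        (B.map fun x => (x.1 + x.2 * ρ, x.2)) (w - 2 * Real.pi * ε * ρ / τ)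
        ((C.translate (-ρ)).path t) * deriv (C.translate (-ρ)).path t
      = Complex.exp (ρ * w - Real.pi * ε * ρ ^ 2 / τ)
        * (foxBarnesIntegrand τ ε m n A B w (C.path t) * deriv C.path t) := by
  have hτ0 : (τ : ℂ) ≠ 0 := by exact_mod_cast hτ
  have hp : (C.translate (-ρ)).path t = C.path t - ρ := (sub_eq_add_neg _ _).symm
  have hd : deriv (C.translate (-ρ)).path t = deriv C.path t := deriv_add_const _
  -- Completing the square: the shift of w by 2περ/τ cancels the cross term in (s-ρ)².
  have he : Complex.exp (Real.pi * ε * (C.path t - ρ) ^ 2 / τ)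
        * Complex.exp (-((C.path t - ρ) * (w - 2 * Real.pi * ε * ρ / τ)))
      = Complex.exp (ρ * w - Real.pi * ε * ρ ^ 2 / τ)
        * (Complex.exp (Real.pi * ε * C.path t ^ 2 / τ) * Complex.exp (-(C.path t * w))) := by
    rw [← Complex.exp_add, ← Complex.exp_add, ← Complex.exp_add]
    congr 1
    field_simp
    ring
  rw [hd, hp, foxBarnesIntegrand, foxBarnesIntegrand, foxBarnesKernel_shift, mul_assoc
    (foxBarnesKernel τ m n A B (C.path t)), he]
  ring

lemma foxBarnes_translate {τ : ℝ} (hτ : τ ≠ 0) {ε : ℂ} {m n : ℕ} {A B : List (ℂ × ℝ)}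
    {C : MBContour} {w : ℂ} (ρ : ℂ) (hi : FoxBarnesConverges τ ε m n A B C w) :
    FoxBarnesConverges τ ε m n (A.map fun x => (x.1 + x.2 * ρ, x.2))
        (B.map fun x => (x.1 + x.2 * ρ, x.2)) (C.translate (-ρ)) (w - 2 * Real.pi * ε * ρ / τ) ∧
      Complex.exp (Real.pi * ε * ρ ^ 2 / τ)
        * foxBarnesI τ ε m n (A.map fun x => (x.1 + x.2 * ρ, x.2))
          (B.map fun x => (x.1 + x.2 * ρ, x.2)) (C.translate (-ρ)) (w - 2 * Real.pi * ε * ρ / τ)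
      = Complex.exp (ρ * w) * foxBarnesI τ ε m n A B C w := by
  refine ⟨?_, ?_⟩
  · simp only [FoxBarnesConverges, foxBarnesIntegrand_translate hτ]
    exact MeasureTheory.Integrable.const_mul hi _
  · simp only [foxBarnesI, foxBarnesIntegrand_translate hτ]
    rw [MeasureTheory.integral_const_mul, mul_left_comm _ (Complex.exp _) (MeasureTheory.integral _ _),
      ← mul_assoc (Complex.exp _) (Complex.exp _), ← Complex.exp_add]
    congr 2
    ring

/-! ### The polynomial factors as extra parameter pairs -/

section Kernels

variable {τ : ℝ} {m n : ℕ} {A B : List (ℂ × ℝ)}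

lemma foxBarnesKernel_falling_left (hτ : 0 < τ) (hm : m ≤ B.length) (ω s : ℂ) (σ : ℝ) (k : ℕ)
    (hs : OffLattice τ (ω - σ * s)) :
    (τ : ℂ) ^ k * foxBarnesKernel τ m (n + 2) ([(-ω, σ), (-ω + k + τ, σ)] ++ A)
        (B ++ [(-ω + τ, σ), (-ω + k, σ)]) s
      = fallingFactorial (ω - σ * s) k * foxBarnesKernel τ m n A B s := by
  rw [foxBarnesKernel_append_left (l := 2) τ n _ A B _ rfl hm s,
    ← doubleGamma_ratio_falling hτ hs k, ← mul_assoc]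
  simp only [List.map_cons, List.map_nil, List.prod_cons, List.prod_nil, mul_one]
  ring_nf

lemma foxBarnesKernel_falling_right (hτ : 0 < τ) (hn : n ≤ A.length) (ω s : ℂ) (σ : ℝ) (k : ℕ)
    (hs : OffLattice τ (ω - σ * s)) :
    (-(τ : ℂ)) ^ k * foxBarnesKernel τ (m + 2) n (A ++ [(k - ω, σ), (τ - ω, σ)])
        ([(k + τ - ω, σ), (-ω, σ)] ++ B) s
      = fallingFactorial (ω - σ * s) k * foxBarnesKernel τ m n A B s := by
  rw [foxBarnesKernel_append_right (l := 2) τ m _ A B _ rfl hn s,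
    ← doubleGamma_ratio_rising hτ hs k, ← mul_assoc]
  simp only [List.map_cons, List.map_nil, List.prod_cons, List.prod_nil, mul_one]
  ring_nf

/-- For the power -σ the falling factorial is that of u = +σs, so `doubleGamma_ratio_falling`
already produces arguments with +σs and no sign appears. -/
lemma foxBarnesKernel_falling_right_neg (hτ : 0 < τ) (hn : n ≤ A.length) (s : ℂ) (σ : ℝ) (k : ℕ)
    (hs : OffLattice τ (σ * s)) :
    (τ : ℂ) ^ k * foxBarnesKernel τ (m + 2) n (A ++ [((1 : ℂ), σ), ((1 - k + τ : ℂ), σ)])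
        ([((1 + τ : ℂ), σ), ((1 - k : ℂ), σ)] ++ B) s
      = fallingFactorial (σ * s) k * foxBarnesKernel τ m n A B s := by
  rw [foxBarnesKernel_append_right (l := 2) τ m _ A B _ rfl hn s,
    ← doubleGamma_ratio_falling hτ hs k, ← mul_assoc]
  simp only [List.map_cons, List.map_nil, List.prod_cons, List.prod_nil, mul_one]
  ring_nf

lemma foxBarnesKernel_euler_left (hτ : 0 < τ) (hm : m ≤ B.length) {k : ℕ} (c : Fin k → ℂ)
    (ω s : ℂ) (σ : ℝ) (hs : ∀ j, OffLattice τ (ω - c j - σ * s)) :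
    (τ : ℂ) ^ k * foxBarnesKernel τ m (n + 2 * k)
        (List.ofFn (fun j => (c j - ω, σ)) ++ List.ofFn (fun j => (1 + τ + c j - ω, σ)) ++ A)
        (B ++ List.ofFn (fun j => (τ + c j - ω, σ)) ++ List.ofFn (fun j => (1 + c j - ω, σ))) s
      = ((List.ofFn c).map fun a => ω - σ * s - a).prod * foxBarnesKernel τ m n A B s := by
  have hτ0 : (τ : ℂ) ≠ 0 := by exact_mod_cast hτ.ne'
  rw [List.append_assoc B, foxBarnesKernel_append_left (l := 2 * k) τ n _ A B _
    (by rw [List.length_append, List.length_ofFn, List.length_ofFn, two_mul]) hm s, ← mul_assoc]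
  congr 1
  simp only [List.map_append, List.prod_append, List.map_ofFn, List.prod_ofFn, Function.comp_def]
  rw [← Finset.prod_mul_distrib, ← Finset.prod_mul_distrib, ← Finset.prod_div_distrib,
    ← Fin.prod_const, ← Finset.prod_mul_distrib]
  refine Finset.prod_congr rfl fun j _ => ?_
  have h := doubleGamma_ratio hτ (hs j)
  rw [eq_div_iff hτ0] at h
  rw [show ω - σ * s - c j = ω - c j - σ * s by ring, ← h]
  ring_nf

lemma foxBarnesKernel_euler_right (hτ : 0 < τ) (hn : n ≤ A.length) {k : ℕ} (c : Fin k → ℂ)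
    (ω s : ℂ) (σ : ℝ) (hs : ∀ j, OffLattice τ (ω - c j - σ * s)) :
    (-(τ : ℂ)) ^ k * foxBarnesKernel τ (m + 2 * k) n
        (A ++ List.ofFn (fun j => (1 + c j - ω, σ)) ++ List.ofFn (fun j => (τ + c j - ω, σ)))
        (List.ofFn (fun j => (1 + τ + c j - ω, σ)) ++ List.ofFn (fun j => (c j - ω, σ)) ++ B) s
      = ((List.ofFn c).map fun a => ω - σ * s - a).prod * foxBarnesKernel τ m n A B s := by
  have hτ0 : (τ : ℂ) ≠ 0 := by exact_mod_cast hτ.ne'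
  rw [List.append_assoc A, foxBarnesKernel_append_right (l := 2 * k) τ m _ A B _
    (by rw [List.length_append, List.length_ofFn, List.length_ofFn, two_mul]) hn s, ← mul_assoc]
  congr 1
  simp only [List.map_append, List.prod_append, List.map_ofFn, List.prod_ofFn, Function.comp_def]
  rw [← Finset.prod_mul_distrib, ← Finset.prod_mul_distrib, ← Finset.prod_div_distrib,
    ← Fin.prod_const, ← Finset.prod_mul_distrib]
  refine Finset.prod_congr rfl fun j _ => ?_
  have h := doubleGamma_ratio hτ (hs j).neg
  rw [eq_div_iff hτ0] at h
  rw [show ω - σ * s - c j = -(-(ω - c j - σ * s)) by ring, ← h]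
  ring_nf

end Kernels

end

/-! ### The differentiation formulas -/

theorem proposition4
    (τ : ℝ) (hτ : 0 < τ) (ε : ℂ) (m n : ℕ) (A B : List (ℂ × ℝ))
    (hn : n ≤ A.length) (hm : m ≤ B.length)
    (hA : ∀ x ∈ A, 0 < x.2) (hB : ∀ x ∈ B, 0 < x.2)
    (C : MBContour) (hC : C.Separates τ m n A B)
    (k : ℕ) (hk : 1 ≤ k) (σ : ℝ) (hσ : 0 < σ) :
    -- (i)
    (∀ (ω z : ℂ) (L : ℂ → ℂ), IsLogBranchAt L (fun x => x) z →
      (∀ᶠ w in 𝓝 (σ * L z), FoxBarnesConverges τ ε m n A B C w) →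
      AnalyticAt ℂ (fun x => Complex.exp (ω * L x) * foxBarnesI τ ε m n A B C (σ * L x)) z ∧
      (FoxBarnesConverges τ ε m (n + 2)
          ([(-ω, σ), (-ω + k + τ, σ)] ++ A) (B ++ [(-ω + τ, σ), (-ω + k, σ)]) C (σ * L z) ∧
        iteratedDeriv k
            (fun x => Complex.exp (ω * L x) * foxBarnesI τ ε m n A B C (σ * L x)) z
          = (τ : ℂ) ^ k * Complex.exp ((ω - k) * L z)
            * foxBarnesI τ ε m (n + 2)
                ([(-ω, σ), (-ω + k + τ, σ)] ++ A) (B ++ [(-ω + τ, σ), (-ω + k, σ)]) C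
                (σ * L z)) ∧
      (FoxBarnesConverges τ ε (m + 2) n
          (A ++ [(k - ω, σ), (τ - ω, σ)]) ([(k + τ - ω, σ), (-ω, σ)] ++ B) C (σ * L z) ∧
        iteratedDeriv k
            (fun x => Complex.exp (ω * L x) * foxBarnesI τ ε m n A B C (σ * L x)) z
          = (-(τ : ℂ)) ^ k * Complex.exp ((ω - k) * L z)
            * foxBarnesI τ ε (m + 2) n
                (A ++ [(k - ω, σ), (τ - ω, σ)]) ([(k + τ - ω, σ), (-ω, σ)] ++ B) C
                (σ * L z)) ∧
      (FoxBarnesConverges τ ε m (n + 2)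
          ([(-(k : ℂ), σ), ((τ : ℂ), σ)] ++ A.map (fun x => (x.1 + x.2 * (ω - k) / σ, x.2)))
          (B.map (fun x => (x.1 + x.2 * (ω - k) / σ, x.2)) ++ [((τ - k : ℂ), σ), ((0 : ℂ), σ)])
          (C.translate (-((ω - k) / σ)))
          (σ * L z - 2 * Real.pi * ε * (ω - k) / (σ * τ)) ∧
        iteratedDeriv k
            (fun x => Complex.exp (ω * L x) * foxBarnesI τ ε m n A B C (σ * L x)) z
          = (τ : ℂ) ^ k * Complex.exp (Real.pi * ε * ((ω - k) / σ) ^ 2 / τ)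
            * foxBarnesI τ ε m (n + 2)
                ([(-(k : ℂ), σ), ((τ : ℂ), σ)]
                  ++ A.map (fun x => (x.1 + x.2 * (ω - k) / σ, x.2)))
                (B.map (fun x => (x.1 + x.2 * (ω - k) / σ, x.2)) ++ [((τ - k : ℂ), σ), ((0 : ℂ), σ)])
                (C.translate (-((ω - k) / σ)))
                (σ * L z - 2 * Real.pi * ε * (ω - k) / (σ * τ)))) ∧
    -- (ii)
    (∀ (ω z : ℂ) (c : Fin k → ℂ) (L : ℂ → ℂ), IsLogBranchAt L (fun x => x) z →
      (∀ᶠ w in 𝓝 (σ * L z), FoxBarnesConverges τ ε m n A B C w) →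
      (FoxBarnesConverges τ ε m (n + 2 * k)
          (List.ofFn (fun j => (c j - ω, σ)) ++ List.ofFn (fun j => (1 + τ + c j - ω, σ)) ++ A)
          (B ++ List.ofFn (fun j => (τ + c j - ω, σ)) ++ List.ofFn (fun j => (1 + c j - ω, σ)))
          C (σ * L z) ∧
        eulerProd c
            (fun x => Complex.exp (ω * L x) * foxBarnesI τ ε m n A B C (σ * L x)) z
          = (τ : ℂ) ^ k * Complex.exp (ω * L z)
            * foxBarnesI τ ε m (n + 2 * k)
                (List.ofFn (fun j => (c j - ω, σ))
                  ++ List.ofFn (fun j => (1 + τ + c j - ω, σ)) ++ A)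
                (B ++ List.ofFn (fun j => (τ + c j - ω, σ))
                  ++ List.ofFn (fun j => (1 + c j - ω, σ)))
                C (σ * L z)) ∧
      (FoxBarnesConverges τ ε (m + 2 * k) n
          (A ++ List.ofFn (fun j => (1 + c j - ω, σ)) ++ List.ofFn (fun j => (τ + c j - ω, σ)))
          (List.ofFn (fun j => (1 + τ + c j - ω, σ)) ++ List.ofFn (fun j => (c j - ω, σ)) ++ B)
          C (σ * L z) ∧
        eulerProd c
            (fun x => Complex.exp (ω * L x) * foxBarnesI τ ε m n A B C (σ * L x)) z
          = (-(τ : ℂ)) ^ k * Complex.exp (ω * L z)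
            * foxBarnesI τ ε (m + 2 * k) n
                (A ++ List.ofFn (fun j => (1 + c j - ω, σ))
                  ++ List.ofFn (fun j => (τ + c j - ω, σ)))
                (List.ofFn (fun j => (1 + τ + c j - ω, σ))
                  ++ List.ofFn (fun j => (c j - ω, σ)) ++ B)
                C (σ * L z))) ∧
    -- (iii)
    (∀ (c d z : ℂ) (L : ℂ → ℂ), IsLogBranchAt L (fun x => c * x + d) z →
      (∀ᶠ w in 𝓝 (σ * L z), FoxBarnesConverges τ ε m n A B C w) →
      AnalyticAt ℂ (fun x => foxBarnesI τ ε m n A B C (σ * L x)) z ∧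
      FoxBarnesConverges τ ε m (n + 2)
          ([((0 : ℂ), σ), ((k + τ : ℂ), σ)] ++ A) (B ++ [((τ : ℂ), σ), ((k : ℂ), σ)]) C (σ * L z) ∧
      iteratedDeriv k (fun x => foxBarnesI τ ε m n A B C (σ * L x)) z
        = (τ : ℂ) ^ k * c ^ k / (c * z + d) ^ k
          * foxBarnesI τ ε m (n + 2)
              ([((0 : ℂ), σ), ((k + τ : ℂ), σ)] ++ A) (B ++ [((τ : ℂ), σ), ((k : ℂ), σ)]) C (σ * L z)) ∧
    -- (iv)
    (∀ (c d z : ℂ) (L : ℂ → ℂ), IsLogBranchAt L (fun x => c * x + d) z →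
      (∀ᶠ w in 𝓝 (-σ * L z), FoxBarnesConverges τ ε m n A B C w) →
      AnalyticAt ℂ (fun x => foxBarnesI τ ε m n A B C (-σ * L x)) z ∧
      FoxBarnesConverges τ ε (m + 2) n
          (A ++ [((1 : ℂ), σ), ((1 - k + τ : ℂ), σ)]) ([((1 + τ : ℂ), σ), ((1 - k : ℂ), σ)] ++ B) C (-σ * L z) ∧
      iteratedDeriv k (fun x => foxBarnesI τ ε m n A B C (-σ * L x)) z
        = (τ : ℂ) ^ k * c ^ k / (c * z + d) ^ k
          * foxBarnesI τ ε (m + 2) n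
              (A ++ [((1 : ℂ), σ), ((1 - k + τ : ℂ), σ)]) ([((1 + τ : ℂ), σ), ((1 - k : ℂ), σ)] ++ B) C (-σ * L z)) := by
  have hτ0 : (τ : ℂ) ≠ 0 := by exact_mod_cast hτ.ne'
  have hσ0 : (σ : ℂ) ≠ 0 := by exact_mod_cast hσ.ne'
  have hs := C.continuous_path
  have hτk : (τ : ℂ) ^ k ≠ 0 := pow_ne_zero k hτ0
  have hnτk : (-(τ : ℂ)) ^ k ≠ 0 := pow_ne_zero k (neg_ne_zero.mpr hτ0)
  refine ⟨fun ω z L hL hi => ?_, fun ω z c L hL hi => ?_, fun c d z L hL hi => ?_,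
    fun c d z L hL hi => ?_⟩
  · have hL' : IsLogBranchAt L (fun x => 1 * x + 0) z := by simpa using hL
    simp only [foxBarnesConverges_iff] at hi
    obtain ⟨hconv, hder⟩ := hL'.iteratedDeriv_powerIntegral hs ω hi k
    have hder' := hder.self_of_nhds
    rw [one_pow, one_mul] at hder'
    obtain ⟨c1, e1⟩ := foxBarnes_of_kernel_eq (q := fun s => fallingFactorial (ω - σ * s) k)
      (fun _ : Unit => ω) hσ0 hτk
      (fun s h => foxBarnesKernel_falling_left hτ hm ω s σ k (h ())) hconv.self_of_nhds
    obtain ⟨c2, e2⟩ := foxBarnes_of_kernel_eq (q := fun s => fallingFactorial (ω - σ * s) k)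
      (fun _ : Unit => ω) hσ0 hnτk
      (fun s h => foxBarnesKernel_falling_right hτ hn ω s σ k (h ())) hconv.self_of_nhds
    rw [exp_mul_foxBarnesI_eq, hder']
    refine ⟨hL'.analyticAt_powerIntegral hs ω hi, ⟨c1, ?_⟩, ⟨c2, ?_⟩, ?_⟩
    · rw [powerIntegral, e1]
      ring
    · rw [powerIntegral, e2]
      ring
    -- With ρ = (ω-k)/σ and w = σL(z), the factor e^(ρw) is exactly the power z^(ω-k), which the
    -- translation absorbs.
    · obtain ⟨c3, e3⟩ := foxBarnes_translate hτ.ne' ((ω - k) / σ) c1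
      have hlist : ∀ a : ℂ, a + σ * ((ω - k) / σ) = a + (ω - k) := fun a => by
        rw [mul_div_cancel₀ _ hσ0]
      simp only [List.map_append, List.map_cons, List.map_nil, hlist] at c3 e3
      have hw : 2 * (Real.pi : ℂ) * ε * ((ω - k) / σ) / τ
          = 2 * Real.pi * ε * (ω - k) / (σ * τ) := by
        field_simp
      have hρ : (ω - k) / σ * (σ * L z) = (ω - k) * L z := by
        field_simp
      rw [hw, hρ] at e3
      rw [hw] at c3
      simp only [← mul_div_assoc] at c3 e3
      rw [show -ω + (ω - (k : ℂ)) = -k by ring, show -ω + k + τ + (ω - k) = (τ : ℂ) by ring,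
        show -ω + τ + (ω - k) = (τ - k : ℂ) by ring, show -ω + k + (ω - k) = 0 by ring] at c3 e3
      refine ⟨c3, ?_⟩
      rw [mul_assoc, e3, powerIntegral, e1]
      ring
  · simp only [foxBarnesConverges_iff] at hi
    obtain ⟨hconv, hder⟩ := hL.foldr_eulerOp_powerIntegral hs ω hi (List.ofFn c)
    have hder' := hder.self_of_nhds
    -- One exceptional lattice for each c_j, hence the family indexed by j.
    obtain ⟨c1, e1⟩ := foxBarnes_of_kernel_eq
      (q := fun s => ((List.ofFn c).map fun a => ω - σ * s - a).prod)
      (fun j => ω - c j) hσ0 hτk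
      (fun s h => foxBarnesKernel_euler_left hτ hm c ω s σ h) hconv.self_of_nhds
    obtain ⟨c2, e2⟩ := foxBarnes_of_kernel_eq
      (q := fun s => ((List.ofFn c).map fun a => ω - σ * s - a).prod)
      (fun j => ω - c j) hσ0 hnτk
      (fun s h => foxBarnesKernel_euler_right hτ hn c ω s σ h) hconv.self_of_nhds
    rw [exp_mul_foxBarnesI_eq, eulerProd, hder']
    refine ⟨⟨c1, ?_⟩, ⟨c2, ?_⟩⟩
    · rw [powerIntegral, e1]
      ring
    · rw [powerIntegral, e2]
      ring
  · simp only [foxBarnesConverges_iff] at hi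
    obtain ⟨hconv, hder⟩ := hL.iteratedDeriv_powerIntegral hs 0 hi k
    obtain ⟨c1, e1⟩ := foxBarnes_of_kernel_eq (q := fun s => fallingFactorial (0 - σ * s) k)
      (fun _ : Unit => 0) hσ0 hτk
      (fun s h => foxBarnesKernel_falling_left hτ hm 0 s σ k (h ())) hconv.self_of_nhds
    simp only [neg_zero, zero_add] at c1 e1
    have hfun := exp_mul_foxBarnesI_eq τ ε m n A B C 0 σ L
    simp only [zero_mul, Complex.exp_zero, one_mul] at hfun
    rw [hfun]
    refine ⟨hL.analyticAt_powerIntegral hs 0 hi, c1, ?_⟩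
    -- With ω = 0, the k lowered exponents give (cz+d)^(-k).
    have hexp : Complex.exp ((0 - k) * L z) = ((c * z + d) ^ k)⁻¹ := by
      rw [zero_sub, neg_mul, Complex.exp_neg, Complex.exp_nat_mul,
        show Complex.exp (L z) = c * z + d from hL.2.self_of_nhds]
    rw [hder.self_of_nhds, powerIntegral, hexp, e1]
    ring
  · simp only [foxBarnesConverges_iff] at hi
    obtain ⟨hconv, hder⟩ := hL.iteratedDeriv_powerIntegral hs 0 hi k
    obtain ⟨c1, e1⟩ := foxBarnes_of_kernel_eq (q := fun s => fallingFactorial (0 - -σ * s) k)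
      (fun _ : Unit => 0) (neg_ne_zero.mpr hσ0) hτk
      (fun s h => by
        have h' := h ()
        rw [neg_mul, zero_sub, neg_neg] at h' ⊢
        exact foxBarnesKernel_falling_right_neg hτ hn s σ k h') hconv.self_of_nhds
    have hfun := exp_mul_foxBarnesI_eq τ ε m n A B C 0 (-σ) L
    simp only [zero_mul, Complex.exp_zero, one_mul] at hfun
    rw [hfun]
    refine ⟨hL.analyticAt_powerIntegral hs 0 hi, c1, ?_⟩
    have hexp : Complex.exp ((0 - k) * L z) = ((c * z + d) ^ k)⁻¹ := by
      rw [zero_sub, neg_mul, Complex.exp_neg, Complex.exp_nat_mul,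
        show Complex.exp (L z) = c * z + d from hL.2.self_of_nhds]
    rw [hder.self_of_nhds, powerIntegral, hexp, e1]
    ring
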